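/- Let $A$ be a unital $C^*$-algebra. Let $U(A)$ be its unitary group with the norm topology and $U_A$ the connected component of $1$ in $U(A)$. For a closed two-sided ideal $I\subseteq A$ let $U_I$ be the connected component of $1$ in the group $\{u\in U(A)\mid u-1\in I\}$. Let $CU_A$ and $CU_I$ be the closures of the commutator subgroups of $U_A$ and of $U_I$, respectively. Let $\mathrm{Aut}(A)$ be the group of $*$-automorphisms of $A$ with the topology of pointwise norm convergence, write $\mathrm{Ad}(u)(a)=uau^*$, and let $V_A$ and $V_I$ be the closures in $\mathrm{Aut}(A)$ of $\{\mathrm{Ad}(u)\mid u\in U_A\}$ and of $\{\mathrm{Ad}(u)\mid u\in U_I\}$, respectively. Write $\mathcal Z(\cdot)$ for the center (of an algebra or of a group), $[S,T]$ for the linear span of $\{xy-yx\mid x\in S,\ y\in T\}$, and $\mathrm{Id}(S)$ for the closed two-sided ideal of $A$ generated by $S$. A closed two-sided ideal $I$ is called perfect if $I=\mathrm{Id}([I,I])$. A topological group is called topologically simple if its only closed normal subgroups are the trivial subgroup and the whole group (so the trivial group is topologically simple). The groups $V_A$ and $CU_A$ carry the subspace topologies and $CU_A/\mathcal Z(CU_A)$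 the quotient topology. Theorem. For every unital $C^*$-algebra $A$ the following are equivalent: 1. For every closed two-sided ideal $I$ of $A$, either $I\subseteq\mathcal Z(A)$ or $A/I$ is abelian. 2. The only perfect ideals of $A$ are $\{0\}$ and $\mathrm{Id}([A,A])$. 3. $V_A$ is topologically simple. 4. $CU_A/\mathcal Z(CU_A)$ is topologically simple. 5. For every closed two-sided ideal $I$ of $A$, $V_I$ is either trivial or equal to $V_A$. 6. For every closed two-sided ideal $I$ of $A$, $CU_I$ is either trivial or equal to $CU_A$. -/

import Mathlib

namespace CStarUnitary

section General

/-- A topological group is topologically simple if its only closed normal subgroups are the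
trivial subgroup and the whole group (the trivial group counts as topologically simple). -/
def TopologicallySimple (G : Type*) [Group G] [TopologicalSpace G] : Prop :=
  ∀ N : Subgroup G, N.Normal → IsClosed (N : Set G) → N = ⊥ ∨ N = ⊤

/-- The closure of the commutator subgroup `(H, H)`. -/
noncomputable def closedCommutator {G : Type*} [Group G] [TopologicalSpace G] [IsTopologicalGroup G]
    (H : Subgroup G) : Subgroup G :=
  (⁅H, H⁆ : Subgroup G).topologicalClosure

end General

section Automorphisms

variable {A : Type*} [CStarAlgebra A]

/-- The topology of pointwise (norm) convergence on the group of `*`-automorphisms. -/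
instance autTopology : TopologicalSpace (A ≃⋆ₐ[ℂ] A) :=
  TopologicalSpace.induced (fun φ (a : A) => φ a) inferInstance

theorem continuous_aut_eval (a : A) : Continuous fun φ : A ≃⋆ₐ[ℂ] A => φ a :=
  (continuous_apply a).comp continuous_induced_dom

theorem continuous_aut_iff {X : Type*} [TopologicalSpace X] (f : X → (A ≃⋆ₐ[ℂ] A)) :
    Continuous f ↔ ∀ a : A, Continuous fun x => f x a := by
  rw [continuous_induced_rng, continuous_pi_iff]
  rfl

theorem dist_aut (φ : A ≃⋆ₐ[ℂ] A) (x y : A) : dist (φ x) (φ y) = dist x y :=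
  (StarAlgEquiv.isometry φ).dist_eq x y

/-- `*`-automorphisms of a C⋆-algebra are isometric, so the pointwise topology is a group
topology. -/
instance autTopologicalGroup : IsTopologicalGroup (A ≃⋆ₐ[ℂ] A) where
  continuous_mul := by
    rw [continuous_aut_iff]
    intro a
    rw [continuous_iff_continuousAt]
    rintro ⟨φ₀, ψ₀⟩
    have h1 : Filter.Tendsto (fun p : (A ≃⋆ₐ[ℂ] A) × (A ≃⋆ₐ[ℂ] A) =>
        dist (p.2 a) (ψ₀ a) + dist (p.1 (ψ₀ a)) (φ₀ (ψ₀ a))) (nhds (φ₀, ψ₀)) (nhds 0) := by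
      have hc : Continuous (fun p : (A ≃⋆ₐ[ℂ] A) × (A ≃⋆ₐ[ℂ] A) =>
          dist (p.2 a) (ψ₀ a) + dist (p.1 (ψ₀ a)) (φ₀ (ψ₀ a))) :=
        (((continuous_aut_eval a).comp continuous_snd).dist continuous_const).add
          (((continuous_aut_eval (ψ₀ a)).comp continuous_fst).dist continuous_const)
      simpa using hc.tendsto (φ₀, ψ₀)
    refine tendsto_iff_dist_tendsto_zero.2 (squeeze_zero (fun _ => dist_nonneg) ?_ h1)
    rintro ⟨φ, ψ⟩
    calc dist (φ (ψ a)) (φ₀ (ψ₀ a))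
        ≤ dist (φ (ψ a)) (φ (ψ₀ a)) + dist (φ (ψ₀ a)) (φ₀ (ψ₀ a)) := dist_triangle _ _ _
      _ = dist (ψ a) (ψ₀ a) + dist (φ (ψ₀ a)) (φ₀ (ψ₀ a)) := by rw [dist_aut]
  continuous_inv := by
    rw [continuous_aut_iff]
    intro a
    rw [continuous_iff_continuousAt]
    intro φ₀
    have h1 : Filter.Tendsto (fun φ : A ≃⋆ₐ[ℂ] A => dist (φ₀ (φ₀⁻¹ a)) (φ (φ₀⁻¹ a)))
        (nhds φ₀) (nhds 0) := by
      have hc : Continuous (fun φ : A ≃⋆ₐ[ℂ] A => dist (φ₀ (φ₀⁻¹ a)) (φ (φ₀⁻¹ a))) :=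
        continuous_const.dist (continuous_aut_eval _)
      simpa using hc.tendsto φ₀
    refine tendsto_iff_dist_tendsto_zero.2 (h1.congr fun φ => ?_)
    have e1 : φ₀ (φ₀⁻¹ a) = a := φ₀.apply_symm_apply a
    have e2 : φ (φ⁻¹ a) = a := φ.apply_symm_apply a
    calc dist (φ₀ (φ₀⁻¹ a)) (φ (φ₀⁻¹ a)) = dist (φ (φ⁻¹ a)) (φ (φ₀⁻¹ a)) := by rw [e1, e2]
      _ = dist (φ⁻¹ a) (φ₀⁻¹ a) := dist_aut _ _ _

end Automorphisms

section Ideals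

variable {A : Type*} [CStarAlgebra A]

/-- The closed two-sided ideal generated by a set `S`: the smallest closed two-sided ideal
containing `S`. -/
noncomputable def closedIdealSpan (S : Set A) : TwoSidedIdeal A :=
  sInf {J : TwoSidedIdeal A | IsClosed (J : Set A) ∧ S ⊆ J}

/-- `[S, T]`: the linear span of the commutators `x y - y x` with `x ∈ S`, `y ∈ T`. -/
noncomputable def commutatorSpan (S T : Set A) : Submodule ℂ A :=
  Submodule.span ℂ {z | ∃ x ∈ S, ∃ y ∈ T, z = x * y - y * x}

/-- A perfect ideal: a closed two-sided ideal `I` that is generated, as a closed two-sided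
ideal, by `[I, I]`. -/
def IsPerfectIdeal (I : TwoSidedIdeal A) : Prop :=
  IsClosed (I : Set A) ∧ I = closedIdealSpan (commutatorSpan (I : Set A) (I : Set A) : Set A)

end Ideals

section UnitaryGroups

variable {A : Type*} [CStarAlgebra A]

/-- `U(I) = {u ∈ U(A) | u - 1 ∈ I}`. -/
noncomputable def unitaryOfIdeal (I : TwoSidedIdeal A) : Subgroup (unitary A) where
  carrier := {u | (u : A) - 1 ∈ I}
  one_mem' := by
    have h : (((1 : unitary A) : A) - 1) = 0 := by simp
    change (((1 : unitary A) : A) - 1) ∈ I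
    rw [h]
    exact I.zero_mem
  mul_mem' := by
    intro u v hu hv
    have h : ((u * v : unitary A) : A) - 1 = (u : A) * ((v : A) - 1) + ((u : A) - 1) := by
      rw [Submonoid.coe_mul, mul_sub, mul_one]
      abel
    change ((u * v : unitary A) : A) - 1 ∈ I
    rw [h]
    exact I.add_mem (I.mul_mem_left _ _ hv) hu
  inv_mem' := by
    intro u hu
    have h : ((u⁻¹ : unitary A) : A) - 1 = -(((u⁻¹ : unitary A) : A) * ((u : A) - 1)) := by
      have h' : ((u⁻¹ : unitary A) : A) * (u : A) = 1 := by
        rw [← Submonoid.coe_mul, inv_mul_cancel, Submonoid.coe_one]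
      rw [mul_sub, h', mul_one]
      abel
    change ((u⁻¹ : unitary A) : A) - 1 ∈ I
    rw [h]
    exact I.neg_mem (I.mul_mem_left _ _ hu)

variable (A) in
/-- `U_A`: the connected component of the identity in `U(A)` (norm topology). -/
noncomputable def U : Subgroup (unitary A) :=
  Subgroup.connectedComponentOfOne (unitary A)

/-- `U_I`: the connected component of the identity in `U(I)`, as a subgroup of `U(A)`. -/
noncomputable def UIdeal (I : TwoSidedIdeal A) : Subgroup (unitary A) :=
  (Subgroup.connectedComponentOfOne (unitaryOfIdeal I)).map (unitaryOfIdeal I).subtype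

variable (A) in
/-- `CU_A`: the closed commutator subgroup of `U_A`. -/
noncomputable def CU : Subgroup (unitary A) :=
  closedCommutator (U A)

/-- `CU_I`: the closed commutator subgroup of `U_I`. -/
noncomputable def CUIdeal (I : TwoSidedIdeal A) : Subgroup (unitary A) :=
  closedCommutator (UIdeal I)

/-- For a group `H` of unitaries, the closure in `Aut(A)` of `{Ad(u) | u ∈ H}`. -/
noncomputable def closureAd (H : Subgroup (unitary A)) : Subgroup (A ≃⋆ₐ[ℂ] A) :=
  (H.map (Unitary.conjStarAlgAut ℂ A)).topologicalClosure

variable (A) in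
/-- `V_A`: the closure in `Aut(A)` of `{Ad(u) | u ∈ U_A}`. -/
noncomputable def V : Subgroup (A ≃⋆ₐ[ℂ] A) :=
  closureAd (U A)

/-- `V_I`: the closure in `Aut(A)` of `{Ad(u) | u ∈ U_I}`. -/
noncomputable def VIdeal (I : TwoSidedIdeal A) : Subgroup (A ≃⋆ₐ[ℂ] A) :=
  closureAd (UIdeal I)

end UnitaryGroups

end CStarUnitary

/-!
A closed group `H` of unitaries has a Lie algebra, the real space `L(H)` of the self-adjoint `a`
with `exp (i t a) ∈ H` for all real `t` (`lieSubspace`, by the Trotter formula). The statements on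
groups are reduced to the algebraic dichotomy for ideals through `L(H)`.

Let `H` be closed and normalized by `CU A`. The complexification `X` of `L(H)` is a closed subspace,
closed under the adjoint and under commutators, and normalized by `[A, A]`, because the Lie algebra
of `CU A` contains `i [x, y]` for all self-adjoint `x`, `y`. By an argument of Herstein, the largest
closed ideal `J` with `[J, A] ⊆ X` also satisfies `[X, A] ⊆ J` (`IsLieSubspace.lie_mem_idealCore`).
Here one uses that closed ideals are semiprime and that a derivation `[x, ·]` with self-adjoint `x`
vanishes if it is nilpotent. Now apply the dichotomy to `J`.

* If `J` is central, then `X` is central, so `u a u⋆ - a` is central for `u ∈ H` and `a` in the Lie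
  algebra of `CU A`. An automorphism `φ` with `φ a = a + z` and `φ z = z` satisfies
  `φⁿ a = a + n z`, and so `z = 0` by isometry; it follows that `H` is central.
* If `A / J` is abelian, then for unitary `u` the commutator `[u ^ n, b]` is, modulo `[J, A]`, `n`
  times a commutator of `u`. Dividing by `n` shows that `[A, A] ⊆ X`
  (`lie_mem_of_lie_mem_ideal`), and integrating this inclusion gives `CU A ≤ H`
  (`CU_le_of_lie_mem`).

So under the dichotomy a closed group normalized by `CU A` is central or contains `CU A`
(`subset_center_or_CU_le`). This settles the statements on `CU`. For `V A` one also needs that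
`Ad (CU A)` is dense in `V A` (`V_le_closureAd_CU`): modulo `L(CU A)`, every self-adjoint element is
close to commuting with any given finite set of unitaries. Otherwise the Hahn–Banach theorem yields
a nonzero bounded functional `g` that vanishes on `[A, A]` and is a finite sum of coboundaries
`φ - φ(u · u⋆)`. Such a `g` is zero (`eq_zero_of_eq_sum_sub_conj`): at a positive contraction which
almost maximizes `g` and then a suitable positive functional `F` dominating the `φ`, the values of
`φ` are almost invariant under conjugation by `u`.

Conversely, each group-theoretic condition, applied to the subgroups defined by a closed ideal `I`,
becomes a statement about commutators modulo `I` after differentiation of one-parameter groups. The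
condition on perfect ideals is equivalent to the dichotomy because the closed ideal generated by
`[I, I]` is always perfect, and a commutative closed ideal is central.
-/

namespace CStarUnitary

/-! ### Closed two-sided ideals -/

section ClosedIdeals

variable {A : Type*} [CStarAlgebra A] {J : TwoSidedIdeal A}

theorem ideal_smul_mem (J : TwoSidedIdeal A) (c : ℂ) {x : A} (hx : x ∈ J) : c • x ∈ J := by
  have h : c • x = (c • (1 : A)) * x := by rw [smul_mul_assoc, one_mul]
  rw [h]
  exact J.mul_mem_left _ _ hx

theorem mem_of_nat_smul_mem {n : ℕ} (hn : n ≠ 0) {x : A} (hx : (n : ℂ) • x ∈ J) : x ∈ J := by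
  have h := ideal_smul_mem J (n : ℂ)⁻¹ hx
  rwa [smul_smul, inv_mul_cancel₀ (Nat.cast_ne_zero.2 hn), one_smul] at h

/-- Approximating `y` by `y f(y⋆y)`, with `f` continuous and vanishing at `0`, shows that closed
two-sided ideals of a C⋆-algebra are semiprime. -/
theorem mem_of_star_mul_self_mem (hJ : IsClosed (J : Set A)) {y : A} (hy : star y * y ∈ J) :
    y ∈ J := by
  set h : A := star y * y with hh
  have hsa : IsSelfAdjoint h := IsSelfAdjoint.star_mul_self y
  change y ∈ (J : Set A)
  rw [← hJ.closure_eq, Metric.mem_closure_iff]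
  intro ε hε
  -- `1 - f` is `t ↦ δ² / (t² + δ²)`, for which `(1 - f)² t` is bounded by `δ`
  obtain ⟨δ, hδ, hδε⟩ : ∃ δ : ℝ, 0 < δ ∧ δ < ε ^ 2 := ⟨ε ^ 2 / 2, by positivity, by
    have : 0 < ε ^ 2 := by positivity
    linarith⟩
  have hpos : ∀ t : ℝ, 0 < t ^ 2 + δ ^ 2 := fun t => by positivity
  have hc : Continuous fun t : ℝ => t / (t ^ 2 + δ ^ 2) :=
    continuous_id.div (by fun_prop) fun t => (hpos t).ne'
  have hc' : Continuous fun t : ℝ => δ ^ 2 / (t ^ 2 + δ ^ 2) :=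
    continuous_const.div (by fun_prop) fun t => (hpos t).ne'
  set k : A := cfc (fun t : ℝ => t / (t ^ 2 + δ ^ 2)) h with hk
  set m : A := cfc (fun t : ℝ => δ ^ 2 / (t ^ 2 + δ ^ 2)) h with hm
  have hhk : h * k = 1 - m := by
    have e1 : h * k = cfc (fun t : ℝ => t * (t / (t ^ 2 + δ ^ 2))) h := by
      rw [cfc_mul _ _ h (by fun_prop) hc.continuousOn, cfc_id' ℝ h]
    have e2 : (1 : A) - m = cfc (fun t : ℝ => 1 - δ ^ 2 / (t ^ 2 + δ ^ 2)) h := by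
      rw [cfc_sub _ _ h (by fun_prop) hc'.continuousOn, cfc_const_one ℝ h]
    rw [e1, e2]
    congr 1
    funext t
    have := (hpos t).ne'
    field_simp
    ring
  have hmsa : star m = m := (cfc_predicate (p := IsSelfAdjoint) _ h).star_eq
  have hbound : ‖m * h * m‖ ≤ δ := by
    have e : m * h * m = cfc (fun t : ℝ => δ ^ 2 / (t ^ 2 + δ ^ 2) * t *
        (δ ^ 2 / (t ^ 2 + δ ^ 2))) h := by
      rw [cfc_mul (fun t : ℝ => δ ^ 2 / (t ^ 2 + δ ^ 2) * t) _ h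
          (hc'.mul continuous_id').continuousOn hc'.continuousOn,
        cfc_mul _ _ h hc'.continuousOn continuous_id'.continuousOn, cfc_id' ℝ h]
    rw [e]
    refine norm_cfc_le hδ.le fun t _ => ?_
    have e' : δ ^ 2 / (t ^ 2 + δ ^ 2) * t * (δ ^ 2 / (t ^ 2 + δ ^ 2)) =
        δ ^ 4 * t / (t ^ 2 + δ ^ 2) ^ 2 := by
      have := (hpos t).ne'
      field_simp
    rw [e', Real.norm_eq_abs, abs_div, abs_mul, abs_of_pos (pow_pos hδ 4),
      abs_of_pos (pow_pos (hpos t) 2), div_le_iff₀ (pow_pos (hpos t) 2)]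
    have h1 : 2 * (δ * |t|) ≤ t ^ 2 + δ ^ 2 := by nlinarith [sq_nonneg (δ - |t|), sq_abs t]
    have h2 : δ ^ 2 ≤ t ^ 2 + δ ^ 2 := by nlinarith [sq_nonneg t]
    have h3 : δ ^ 2 * (δ * |t|) ≤ (t ^ 2 + δ ^ 2) ^ 2 := by
      rw [sq (t ^ 2 + δ ^ 2)]
      refine mul_le_mul h2 ?_ (by positivity) (hpos t).le
      have : 0 ≤ δ * |t| := by positivity
      linarith
    nlinarith
  refine ⟨y * (h * k), J.mul_mem_left _ _ (J.mul_mem_right _ _ hy), ?_⟩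
  rw [dist_eq_norm, hhk, mul_sub, mul_one, sub_sub_cancel]
  have hn : ‖y * m‖ * ‖y * m‖ ≤ δ := by
    rw [← CStarRing.norm_star_mul_self]
    rw [star_mul, hmsa]
    simpa only [hh, mul_assoc] using hbound
  nlinarith [norm_nonneg (y * m)]

theorem star_mem_ideal (hJ : IsClosed (J : Set A)) {x : A} (hx : x ∈ J) : star x ∈ J :=
  mem_of_star_mul_self_mem hJ (by rw [star_star]; exact J.mul_mem_right _ _ hx)

theorem mem_of_mul_star_self_mem (hJ : IsClosed (J : Set A)) {y : A} (hy : y * star y ∈ J) :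
    y ∈ J := by
  have h : star y ∈ J := mem_of_star_mul_self_mem hJ (by rwa [star_star])
  simpa using star_mem_ideal hJ h

/-- A commutative ideal is central (modulo `J`). -/
theorem lie_mem_of_lie_mem (hJ : IsClosed (J : Set A)) {I : TwoSidedIdeal A}
    (hI : IsClosed (I : Set A)) (h : ∀ x ∈ I, ∀ y ∈ I, ⁅x, y⁆ ∈ J) {x : A} (hx : x ∈ I) (a : A) :
    ⁅x, a⁆ ∈ J := by
  have key : ∀ y ∈ I, y * ⁅x, a⁆ ∈ J := by
    intro y hy
    have e : y * ⁅x, a⁆ = ⁅x, y * a⁆ - ⁅x, y⁆ * a := by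
      simp only [Ring.lie_def]; noncomm_ring
    rw [e]
    exact J.sub_mem (h _ hx _ (I.mul_mem_right _ _ hy)) (J.mul_mem_right _ _ (h _ hx _ hy))
  refine mem_of_star_mul_self_mem hJ (key _ (star_mem_ideal hI ?_))
  rw [Ring.lie_def]
  exact I.sub_mem (I.mul_mem_right _ _ hx) (I.mul_mem_left _ _ hx)

/-- An element that is central and of square zero modulo `J` belongs to `J`. -/
theorem mem_of_mul_self_mem_of_central (hJ : IsClosed (J : Set A)) {z : A}
    (hz : ∀ a, ⁅z, a⁆ ∈ J) (hzz : z * z ∈ J) : z ∈ J := by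
  refine mem_of_star_mul_self_mem hJ (mem_of_star_mul_self_mem hJ ?_)
  have e : star (star z * z) * (star z * z) =
      star z * ⁅z, star z⁆ * z + star z * star z * (z * z) := by
    simp only [Ring.lie_def, star_mul, star_star]; noncomm_ring
  rw [e]
  exact J.add_mem (J.mul_mem_right _ _ (J.mul_mem_left _ _ (hz _))) (J.mul_mem_left _ _ hzz)

/-- If the commutators of an ideal `I` are central modulo `J`, then they lie in `J`: from
`⁅x, x y⁆ = x ⁅x, y⁆` the square of `⁅x, y⁆` is in `J`. -/
theorem lie_mem_of_lie_central (hJ : IsClosed (J : Set A)) {I : Set A}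
    (hI : ∀ x ∈ I, ∀ y ∈ I, x * y ∈ I)
    (h : ∀ x ∈ I, ∀ y ∈ I, ∀ a, ⁅⁅x, y⁆, a⁆ ∈ J) {x y : A} (hx : x ∈ I) (hy : y ∈ I) :
    ⁅x, y⁆ ∈ J := by
  refine mem_of_mul_self_mem_of_central hJ (h x hx y hy) ?_
  have e : ⁅x, y⁆ * ⁅x, y⁆ = ⁅⁅x, x * y⁆, y⁆ - x * ⁅⁅x, y⁆, y⁆ := by
    simp only [Ring.lie_def]; noncomm_ring
  rw [e]
  exact J.sub_mem (h _ hx _ (hI _ hx _ hy) _) (J.mul_mem_left _ _ (h _ hx _ hy _))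

theorem star_lie_of_isSelfAdjoint {x : A} (hx : IsSelfAdjoint x) (a : A) :
    star ⁅x, a⁆ = -⁅x, star a⁆ := by
  simp only [Ring.lie_def, star_sub, star_mul, hx.star_eq]; abel

/-- For self-adjoint `x` the square of the derivation `⁅x, ·⁆` vanishes (modulo `J`) only if the
derivation does, because of the Leibniz rule `δ²(ab) = δ²(a) b + 2 δ(a) δ(b) + a δ²(b)`. -/
theorem lie_mem_of_lie_lie_mem (hJ : IsClosed (J : Set A)) {x : A} (hx : IsSelfAdjoint x)
    (h : ∀ a, ⁅x, ⁅x, a⁆⁆ ∈ J) (a : A) : ⁅x, a⁆ ∈ J := by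
  have key : ∀ a b, ⁅x, a⁆ * ⁅x, b⁆ ∈ J := by
    intro a b
    refine mem_of_nat_smul_mem (n := 2) two_ne_zero ?_
    have e : ((2 : ℕ) : ℂ) • (⁅x, a⁆ * ⁅x, b⁆) =
        ⁅x, ⁅x, a * b⁆⁆ - ⁅x, ⁅x, a⁆⁆ * b - a * ⁅x, ⁅x, b⁆⁆ := by
      rw [Nat.cast_smul_eq_nsmul]
      simp only [Ring.lie_def]; noncomm_ring
    rw [e]
    exact J.sub_mem (J.sub_mem (h _) (J.mul_mem_right _ _ (h _))) (J.mul_mem_left _ _ (h _))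
  refine mem_of_mul_star_self_mem hJ ?_
  rw [star_lie_of_isSelfAdjoint hx, mul_neg]
  exact J.neg_mem (key _ _)

/-- The Leibniz rule for `δ³(a δ(b))`, where `δ = ⁅x, ·⁆`, gives `3 δ²(a) δ²(b) = 0` modulo `J`
if `δ³ = 0` modulo `J`. -/
theorem lie_lie_mem_of_lie_lie_lie_mem (hJ : IsClosed (J : Set A)) {x : A}
    (hx : IsSelfAdjoint x) (h : ∀ a, ⁅x, ⁅x, ⁅x, a⁆⁆⁆ ∈ J) (a : A) : ⁅x, ⁅x, a⁆⁆ ∈ J := by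
  have key : ∀ a b, ⁅x, ⁅x, a⁆⁆ * ⁅x, ⁅x, b⁆⁆ ∈ J := by
    intro a b
    refine mem_of_nat_smul_mem (n := 3) three_ne_zero ?_
    have e : ((3 : ℕ) : ℂ) • (⁅x, ⁅x, a⁆⁆ * ⁅x, ⁅x, b⁆⁆) =
        ⁅x, ⁅x, ⁅x, a * ⁅x, b⁆⁆⁆⁆ - ⁅x, ⁅x, ⁅x, a⁆⁆⁆ * ⁅x, b⁆ -
          (3 : ℕ) • (⁅x, a⁆ * ⁅x, ⁅x, ⁅x, b⁆⁆⁆) - a * ⁅x, ⁅x, ⁅x, ⁅x, b⁆⁆⁆⁆ := by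
      rw [Nat.cast_smul_eq_nsmul]
      simp only [Ring.lie_def]; noncomm_ring
    rw [e]
    exact J.sub_mem (J.sub_mem (J.sub_mem (h _) (J.mul_mem_right _ _ (h _)))
      (J.nsmul_mem _ (J.mul_mem_left _ _ (h _)))) (J.mul_mem_left _ _ (h _))
  refine mem_of_mul_star_self_mem hJ ?_
  have e : star ⁅x, ⁅x, a⁆⁆ = ⁅x, ⁅x, star a⁆⁆ := by
    simp only [Ring.lie_def, star_sub, star_mul, hx.star_eq]; noncomm_ring
  rw [e]
  exact key _ _

end ClosedIdeals

/-! ### Lie subspaces and the ideals that sandwich them -/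

section LieIdeals

variable {A : Type*} [CStarAlgebra A]

/-- `X` is normalized by `[A, A]`: it is a Lie module over the commutators of `A`. -/
def NormalizedByCommutators (X : Submodule ℂ A) : Prop :=
  ∀ x ∈ X, ∀ a b : A, ⁅x, ⁅a, b⁆⁆ ∈ X

/-- The elements `n` with `[n, A] ⊆ X`. -/
def lieTransporter (X : Submodule ℂ A) : Submodule ℂ A where
  carrier := {n | ∀ a, ⁅n, a⁆ ∈ X}
  add_mem' := by
    intro n m hn hm a
    have e : ⁅n + m, a⁆ = ⁅n, a⁆ + ⁅m, a⁆ := by simp only [Ring.lie_def]; noncomm_ring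
    rw [e]
    exact X.add_mem (hn a) (hm a)
  zero_mem' := by
    intro a
    simp [Ring.lie_def]
  smul_mem' := by
    intro c n hn a
    have e : ⁅c • n, a⁆ = c • ⁅n, a⁆ := by
      simp only [Ring.lie_def, smul_mul_assoc, mul_smul_comm, smul_sub]
    rw [e]
    exact X.smul_mem c (hn a)

theorem mul_mem_lieTransporter {X : Submodule ℂ A} {n m : A} (hn : n ∈ lieTransporter X)
    (hm : m ∈ lieTransporter X) : n * m ∈ lieTransporter X := by
  intro a
  have e : ⁅n * m, a⁆ = ⁅n, m * a⁆ + ⁅m, a * n⁆ := by simp only [Ring.lie_def]; noncomm_ring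
  rw [e]
  exact X.add_mem (hn _) (hm _)

theorem NormalizedByCommutators.lieTransporter {X : Submodule ℂ A}
    (hX : NormalizedByCommutators X) : NormalizedByCommutators (lieTransporter X) := by
  intro n hn b c a
  have e : ⁅⁅n, ⁅b, c⁆⁆, a⁆ = ⁅n, ⁅⁅b, c⁆, a⁆⁆ + ⁅⁅n, a⁆, ⁅b, c⁆⁆ := by
    simp only [Ring.lie_def]; noncomm_ring
  rw [e]
  exact X.add_mem (hn _) (hX _ (hn a) _ _)

theorem NormalizedByCommutators.lie_mem_lieTransporter {X : Submodule ℂ A}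
    (hX : NormalizedByCommutators X) {x y : A} (hx : x ∈ X) (hy : y ∈ X) :
    ⁅x, y⁆ ∈ CStarUnitary.lieTransporter X := by
  intro a
  have e : ⁅⁅x, y⁆, a⁆ = ⁅x, ⁅y, a⁆⁆ - ⁅y, ⁅x, a⁆⁆ := by simp only [Ring.lie_def]; noncomm_ring
  rw [e]
  exact X.sub_mem (hX _ hx _ _) (hX _ hy _ _)

theorem commutatorSpan_le {Y : Submodule ℂ A} {S : Set A}
    (h : ∀ x ∈ S, ∀ y ∈ S, ⁅x, y⁆ ∈ Y) : commutatorSpan S S ≤ Y := by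
  refine Submodule.span_le.2 ?_
  rintro _ ⟨x, hx, y, hy, rfl⟩
  exact h x hx y hy

theorem lie_mem_commutatorSpan {S T : Set A} {x y : A} (hx : x ∈ S) (hy : y ∈ T) :
    ⁅x, y⁆ ∈ commutatorSpan S T :=
  Submodule.subset_span ⟨x, hx, y, hy, rfl⟩

/-- A complex subspace that is closed under the adjoint and under commutators and is normalized by
`[A, A]`. These properties pass to the derived subspace `[X, X]`. -/
structure IsLieSubspace (X : Submodule ℂ A) : Prop where
  normalized : NormalizedByCommutators X
  star_mem : ∀ x ∈ X, star x ∈ X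
  lie_mem : ∀ x ∈ X, ∀ y ∈ X, ⁅x, y⁆ ∈ X

theorem IsLieSubspace.derived {X : Submodule ℂ A} (hX : IsLieSubspace X) :
    IsLieSubspace (commutatorSpan (X : Set A) (X : Set A)) := by
  have hle : commutatorSpan (X : Set A) (X : Set A) ≤ X := commutatorSpan_le hX.lie_mem
  refine ⟨?_, ?_, fun x hx y hy => lie_mem_commutatorSpan (hle hx) (hle hy)⟩
  · intro z hz a b
    induction hz using Submodule.span_induction with
    | mem z hz =>
      obtain ⟨x, hx, y, hy, rfl⟩ := hz
      have e : ⁅x * y - y * x, ⁅a, b⁆⁆ = ⁅⁅x, ⁅a, b⁆⁆, y⁆ + ⁅x, ⁅y, ⁅a, b⁆⁆⁆ := by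
        simp only [Ring.lie_def]; noncomm_ring
      rw [e]
      exact Submodule.add_mem _ (lie_mem_commutatorSpan (hX.normalized _ hx _ _) hy)
        (lie_mem_commutatorSpan hx (hX.normalized _ hy _ _))
    | zero => simp [Ring.lie_def]
    | add z w _ _ hz hw =>
      have e : ⁅z + w, ⁅a, b⁆⁆ = ⁅z, ⁅a, b⁆⁆ + ⁅w, ⁅a, b⁆⁆ := by
        simp only [Ring.lie_def]; noncomm_ring
      rw [e]
      exact Submodule.add_mem _ hz hw
    | smul c z _ hz =>
      have e : ⁅c • z, ⁅a, b⁆⁆ = c • ⁅z, ⁅a, b⁆⁆ := by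
        simp only [Ring.lie_def, smul_mul_assoc, mul_smul_comm, smul_sub]
      rw [e]
      exact Submodule.smul_mem _ c hz
  · intro z hz
    induction hz using Submodule.span_induction with
    | mem z hz =>
      obtain ⟨x, hx, y, hy, rfl⟩ := hz
      rw [star_sub, star_mul, star_mul]
      exact lie_mem_commutatorSpan (hX.star_mem _ hy) (hX.star_mem _ hx)
    | zero => simp
    | add z w _ _ hz hw =>
      rw [star_add]
      exact Submodule.add_mem _ hz hw
    | smul c z _ hz =>
      rw [star_smul]
      exact Submodule.smul_mem _ _ hz

open ComplexStarModule in
/-- If `[X, X]` is central modulo `J`, then so is `X`. For self-adjoint `x ∈ X` put `δ = ⁅x, ·⁆`.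
Then `δ³(a) ∈ [X, X]` is central modulo `J` for all `a`, so that modulo `J`
`δ(b) δ³(a) = ⁅x δ³(a), b⁆ = ⁅δ³(x a), b⁆ = 0`. As `-δ³(a)⋆` is a value of `δ`, this gives
`δ³ = 0` and thus `δ = 0` modulo `J`. -/
theorem IsLieSubspace.lie_mem_of_derived {X : Submodule ℂ A} (hX : IsLieSubspace X)
    {J : TwoSidedIdeal A} (hJ : IsClosed (J : Set A))
    (h : ∀ z ∈ commutatorSpan (X : Set A) (X : Set A), ∀ a, ⁅z, a⁆ ∈ J) :
    ∀ x ∈ X, ∀ a, ⁅x, a⁆ ∈ J := by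
  have main : ∀ x ∈ X, IsSelfAdjoint x → ∀ a, ⁅x, a⁆ ∈ J := by
    intro x hx hsa
    have h3 : ∀ a b, ⁅⁅x, ⁅x, ⁅x, a⁆⁆⁆, b⁆ ∈ J := fun a b =>
      h _ (lie_mem_commutatorSpan hx (hX.normalized _ hx _ _)) b
    have key : ∀ a b, ⁅x, b⁆ * ⁅x, ⁅x, ⁅x, a⁆⁆⁆ ∈ J := by
      intro a b
      have e : ⁅x, b⁆ * ⁅x, ⁅x, ⁅x, a⁆⁆⁆ =
          ⁅⁅x, ⁅x, ⁅x, x * a⁆⁆⁆, b⁆ - x * ⁅⁅x, ⁅x, ⁅x, a⁆⁆⁆, b⁆ := by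
        simp only [Ring.lie_def]; noncomm_ring
      rw [e]
      exact J.sub_mem (h3 _ _) (J.mul_mem_left _ _ (h3 _ _))
    have h3' : ∀ a, ⁅x, ⁅x, ⁅x, a⁆⁆⁆ ∈ J := by
      intro a
      refine mem_of_star_mul_self_mem hJ ?_
      rw [star_lie_of_isSelfAdjoint hsa, neg_mul]
      exact J.neg_mem (key _ _)
    exact lie_mem_of_lie_lie_mem hJ hsa (lie_lie_mem_of_lie_lie_lie_mem hJ hsa h3')
  intro x hx a
  have hre : ((realPart x : selfAdjoint A) : A) ∈ X := by
    rw [realPart_apply_coe, ← Complex.coe_smul]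
    exact X.smul_mem _ (X.add_mem hx (hX.star_mem _ hx))
  have him : ((imaginaryPart x : selfAdjoint A) : A) ∈ X := by
    rw [imaginaryPart_apply_coe, ← Complex.coe_smul]
    exact X.smul_mem _ (X.smul_mem _ (X.sub_mem hx (hX.star_mem _ hx)))
  have e : ⁅x, a⁆ = ⁅((realPart x : selfAdjoint A) : A), a⁆ +
      Complex.I • ⁅((imaginaryPart x : selfAdjoint A) : A), a⁆ := by
    conv_lhs => rw [← realPart_add_I_smul_imaginaryPart x]
    simp only [Ring.lie_def, add_mul, mul_add, smul_mul_assoc, mul_smul_comm, smul_sub]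
    abel
  rw [e]
  exact J.add_mem (main _ hre (realPart x).2 a)
    (ideal_smul_mem J _ (main _ him (imaginaryPart x).2 a))

/-- The largest two-sided ideal `J` with `[J, A] ⊆ X`. -/
def idealCore (X : Submodule ℂ A) : TwoSidedIdeal A :=
  .mk' {x | ∀ a b, a * x * b ∈ lieTransporter X}
    (by intro a b; simp)
    (by
      intro x y hx hy a b
      have e : a * (x + y) * b = a * x * b + a * y * b := by noncomm_ring
      rw [e]
      exact Submodule.add_mem _ (hx a b) (hy a b))
    (by
      intro x hx a b
      have e : a * -x * b = -(a * x * b) := by noncomm_ring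
      rw [e]
      exact Submodule.neg_mem _ (hx a b))
    (by
      intro x y hy a b
      rw [← mul_assoc]
      exact hy (a * x) b)
    (by
      intro x y hx a b
      rw [← mul_assoc, mul_assoc (a * x)]
      exact hx a (y * b))

theorem mem_idealCore {X : Submodule ℂ A} {x : A} :
    x ∈ idealCore X ↔ ∀ a b c, ⁅a * x * b, c⁆ ∈ X := by
  rw [idealCore, TwoSidedIdeal.mem_mk']
  rfl

theorem isClosed_idealCore {X : Submodule ℂ A} (hX : IsClosed (X : Set A)) :
    IsClosed (idealCore X : Set A) := by
  have e : (idealCore X : Set A) =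
      ⋂ a, ⋂ b, ⋂ c, (fun x => a * x * b * c - c * (a * x * b)) ⁻¹' (X : Set A) := by
    ext x
    simp only [SetLike.mem_coe, mem_idealCore, Ring.lie_def, Set.mem_iInter, Set.mem_preimage]
  rw [e]
  exact isClosed_iInter fun a => isClosed_iInter fun b => isClosed_iInter fun c =>
    hX.preimage (by fun_prop)

theorem lie_mem_of_mem_idealCore {X : Submodule ℂ A} {x : A} (hx : x ∈ idealCore X) (a : A) :
    ⁅x, a⁆ ∈ X := by
  simpa using mem_idealCore.1 hx 1 1 a

/-- A closed Lie subspace `X` is sandwiched by the ideal `J = idealCore X`: besides `[J, A] ⊆ X`,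
which is clear, `[X, A] ⊆ J`. Indeed `J` contains the third derived commutators of `X`, by
Herstein's identity `⁅n, m⁆ a = ⁅n, m a⁆ - m ⁅n, a⁆`, and a subspace with that property is central
modulo `J`. -/
theorem IsLieSubspace.lie_mem_idealCore {X : Submodule ℂ A} (hX : IsLieSubspace X)
    (hcl : IsClosed (X : Set A)) : ∀ x ∈ X, ∀ a, ⁅x, a⁆ ∈ idealCore X := by
  set J := idealCore X
  have hJ : IsClosed (J : Set A) := isClosed_idealCore hcl
  have hN0 := hX.normalized
  have hN1 := hN0.lieTransporter
  have hN2 := hN1.lieTransporter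
  set S₁ := lieTransporter X
  set S₂ := lieTransporter S₁
  set S₃ := lieTransporter S₂
  set D₁ := commutatorSpan (X : Set A) (X : Set A)
  set D₂ := commutatorSpan (D₁ : Set A) (D₁ : Set A)
  set D₃ := commutatorSpan (D₂ : Set A) (D₂ : Set A)
  have hD1 : IsLieSubspace D₁ := hX.derived
  have hD2 : IsLieSubspace D₂ := hD1.derived
  have hD3 : IsLieSubspace D₃ := hD2.derived
  have d10 : D₁ ≤ X := commutatorSpan_le hX.lie_mem
  have d21 : D₂ ≤ D₁ := commutatorSpan_le hD1.lie_mem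
  have d32 : D₃ ≤ D₂ := commutatorSpan_le hD2.lie_mem
  have e1 : D₁ ≤ S₁ :=
    commutatorSpan_le fun x hx y hy => hN0.lie_mem_lieTransporter hx hy
  have e2 : D₂ ≤ S₂ :=
    commutatorSpan_le fun x hx y hy => hN1.lie_mem_lieTransporter (e1 hx) (e1 hy)
  have e3 : D₃ ≤ S₃ :=
    commutatorSpan_le fun x hx y hy => hN2.lie_mem_lieTransporter (e2 hx) (e2 hy)
  have hmem : ∀ n ∈ D₃, ∀ m ∈ D₃, ⁅n, m⁆ ∈ J := by
    intro n hn m hm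
    have hid : ∀ a, ⁅n, m⁆ * a = ⁅n, m * a⁆ - m * ⁅n, a⁆ := by
      intro a; simp only [Ring.lie_def]; noncomm_ring
    have h1 : ∀ a, ⁅n, m⁆ * a ∈ S₁ := by
      intro a
      rw [hid]
      exact S₁.sub_mem (e2 (d32 hn) _)
        (mul_mem_lieTransporter (e1 (d21 (d32 hm))) (e2 (d32 hn) _))
    have h2 : ∀ a, ⁅n, m⁆ * a ∈ S₂ := by
      intro a
      rw [hid]
      exact S₂.sub_mem (e3 hn _) (mul_mem_lieTransporter (e2 (d32 hm)) (e3 hn _))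
    rw [mem_idealCore]
    intro b a
    have e : b * ⁅n, m⁆ * a = ⁅n, m⁆ * (a * b) - ⁅⁅n, m⁆ * a, b⁆ := by
      simp only [Ring.lie_def]; noncomm_ring
    have : b * ⁅n, m⁆ * a ∈ S₁ := by
      rw [e]
      exact S₁.sub_mem (h1 _) (h2 _ _)
    exact this
  have c3 : ∀ x ∈ D₃, ∀ a, ⁅x, a⁆ ∈ J := by
    refine hD3.lie_mem_of_derived hJ fun z hz a => ?_
    have hzJ : z ∈ J := by
      induction hz using Submodule.span_induction with
      | mem z hz =>
        obtain ⟨x, hx, y, hy, rfl⟩ := hz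
        exact hmem x hx y hy
      | zero => exact J.zero_mem
      | add z w _ _ hz hw => exact J.add_mem hz hw
      | smul c z _ hz => exact ideal_smul_mem J c hz
    exact J.sub_mem (J.mul_mem_right _ _ hzJ) (J.mul_mem_left _ _ hzJ)
  exact hX.lie_mem_of_derived hJ (hD1.lie_mem_of_derived hJ (hD2.lie_mem_of_derived hJ c3))

/-- If `J` contains all commutators then `[A, A]` lies in every closed subspace containing
`[J, A]`. For a unitary `u`, modulo `[J, A]` one has `⁅u ^ n, a u⁻ⁿ u⁆ = n ⁅u, a⁆`; the left side is
bounded in `n`, so `⁅u, a⁆` is a limit of elements of `[J, A]`. -/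
theorem lie_mem_of_lie_mem_ideal {X : Submodule ℂ A} (hcl : IsClosed (X : Set A))
    {J : TwoSidedIdeal A} (hJX : ∀ x ∈ J, ∀ a, ⁅x, a⁆ ∈ X) (hJ : ∀ a b : A, ⁅a, b⁆ ∈ J) (a b : A) :
    ⁅a, b⁆ ∈ X := by
  have key : ∀ u : unitary A, ∀ b, ⁅(u : A), b⁆ ∈ X := by
    intro u b
    have step : ∀ (n : ℕ) (c : A),
        ⁅(u : A) ^ (n + 1), c⁆ - (n + 1) • (⁅(u : A), c⁆ * (u : A) ^ n) ∈ X := by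
      intro n
      induction n with
      | zero => intro c; simp
      | succ k ih =>
        intro c
        have e : ⁅(u : A) ^ (k + 1 + 1), c⁆ - (k + 1 + 1) • (⁅(u : A), c⁆ * (u : A) ^ (k + 1)) =
            (⁅(u : A) ^ (k + 1), c * u⁆ - (k + 1) • (⁅(u : A), c * u⁆ * (u : A) ^ k)) -
              ⁅⁅(u : A), c⁆, (u : A) ^ (k + 1)⁆ := by
          have e1 : ⁅(u : A), c * u⁆ * (u : A) ^ k = ⁅(u : A), c⁆ * (u : A) ^ (k + 1) := by
            rw [pow_succ']; simp only [Ring.lie_def]; noncomm_ring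
          have e2 : c * (u : A) ^ (k + 1 + 1) = c * ((u : A) * (u : A) ^ (k + 1)) := by
            rw [pow_succ' _ (k + 1)]
          rw [e1, succ_nsmul, Ring.lie_def, e2, pow_succ _ (k + 1)]
          simp only [Ring.lie_def, sub_mul, mul_sub, mul_assoc]
          abel
        rw [e]
        exact X.sub_mem (ih (c * u)) (hJX _ (hJ u c) _)
    change ⁅(u : A), b⁆ ∈ (X : Set A)
    rw [← hcl.closure_eq, Metric.mem_closure_iff]
    intro ε hε
    obtain ⟨n, hn⟩ := exists_nat_gt (2 * ‖b‖ / ε)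
    have hn0 : (0 : ℝ) < (n + 1 : ℕ) := by positivity
    set c : A := b * ((star u ^ n : unitary A) : A) with hc
    have huc : ⁅(u : A), c⁆ * (u : A) ^ n = ⁅(u : A), b⁆ := by
      have h1 : ((star u ^ n : unitary A) : A) * (u : A) ^ n = 1 := by
        rw [← SubmonoidClass.coe_pow, ← Submonoid.coe_mul, Unitary.star_eq_inv, inv_pow,
          inv_mul_cancel, Submonoid.coe_one]
      have h2 : (u : A) * (u : A) ^ n = (u : A) ^ n * u := by rw [← pow_succ', pow_succ]
      calc ⁅(u : A), c⁆ * (u : A) ^ n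
          = u * b * (((star u ^ n : unitary A) : A) * (u : A) ^ n) -
            b * ((star u ^ n : unitary A) : A) * (u * (u : A) ^ n) := by
              simp only [Ring.lie_def, hc]; noncomm_ring
        _ = u * b - b * (((star u ^ n : unitary A) : A) * (u : A) ^ n) * u := by
              rw [h2, h1, mul_one, mul_assoc b, ← mul_assoc _ _ (u : A), h1]; simp
        _ = ⁅(u : A), b⁆ := by rw [h1, mul_one, Ring.lie_def]
    refine ⟨⁅(u : A), b⁆ - ((n + 1 : ℕ) : ℂ)⁻¹ • ⁅(u : A) ^ (n + 1), c⁆, ?_, ?_⟩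
    · have h := X.smul_mem (-((n + 1 : ℕ) : ℂ)⁻¹) (step n c)
      rw [huc, smul_sub, ← Nat.cast_smul_eq_nsmul ℂ (n + 1), smul_smul, neg_mul,
        inv_mul_cancel₀ (Nat.cast_ne_zero.2 n.succ_ne_zero), neg_smul, neg_smul, one_smul,
        sub_neg_eq_add, neg_add_eq_sub] at h
      exact h
    · rw [dist_eq_norm, sub_sub_cancel, norm_smul, norm_inv, RCLike.norm_natCast,
        inv_mul_lt_iff₀ hn0]
      have hcb : ‖c‖ = ‖b‖ := CStarRing.norm_mul_coe_unitary _ _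
      have h1 : ‖(u : A) ^ (n + 1) * c‖ = ‖b‖ := by
        rw [← SubmonoidClass.coe_pow, CStarRing.norm_coe_unitary_mul, hcb]
      have h2 : ‖c * (u : A) ^ (n + 1)‖ = ‖b‖ := by
        rw [← SubmonoidClass.coe_pow, CStarRing.norm_mul_coe_unitary, hcb]
      have h3 : ‖⁅(u : A) ^ (n + 1), c⁆‖ ≤ 2 * ‖b‖ := by
        rw [Ring.lie_def]
        refine (norm_sub_le _ _).trans ?_
        rw [h1, h2]
        linarith
      rw [div_lt_iff₀ hε] at hn
      push_cast
      nlinarith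
  have hspan : a ∈ Submodule.span ℂ (unitary A : Set A) := by
    rw [CStarAlgebra.span_unitary]; trivial
  have hle : Submodule.span ℂ (unitary A : Set A) ≤ lieTransporter X :=
    Submodule.span_le.2 fun u hu => key ⟨u, hu⟩
  exact hle hspan b

end LieIdeals

/-! ### Lie algebras of closed groups of unitaries -/

section OneParameterSubgroups

open selfAdjoint Filter Topology

variable {A : Type*} [CStarAlgebra A]

theorem unitary_norm_sub_eq (u v w : unitary A) : ‖(u : A) * w - v * w‖ = ‖(u : A) - v‖ := by
  rw [← sub_mul, CStarRing.norm_mul_coe_unitary]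

/-- A unitary belongs to a closed subgroup `H` if it is the end point of discrete paths of `n`
steps, each of which is within `ε / n` of a translation by an element of `H`. -/
theorem mem_of_forall_discrete_path {H : Subgroup (unitary A)} (hH : IsClosed (H : Set (unitary A)))
    {g : unitary A}
    (h : ∀ ε : ℝ, 0 < ε → ∃ (n : ℕ) (G : ℕ → unitary A), G 0 = 1 ∧ G n = g ∧
      ∀ k < n, ∃ h ∈ H, ‖(G (k + 1) : A) - h * G k‖ ≤ ε / n) : g ∈ H := by
  change g ∈ (H : Set (unitary A))
  rw [← hH.closure_eq, Metric.mem_closure_iff]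
  intro ε hε
  obtain ⟨n, G, h0, hn, hG⟩ := h (ε / 2) (by positivity)
  have key : ∀ k ≤ n, ∃ h ∈ H, ‖(G k : A) - h‖ ≤ k * (ε / 2 / n) := by
    intro k
    induction k with
    | zero => intro _; exact ⟨1, H.one_mem, by simp [h0]⟩
    | succ k ih =>
      intro hk
      obtain ⟨h₁, hh₁, e₁⟩ := ih (by omega)
      obtain ⟨h₂, hh₂, e₂⟩ := hG k (by omega)
      refine ⟨h₂ * h₁, H.mul_mem hh₂ hh₁, ?_⟩
      have e : (G (k + 1) : A) - (h₂ * h₁ : unitary A) =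
          ((G (k + 1) : A) - h₂ * G k) + h₂ * ((G k : A) - h₁) := by
        rw [Submonoid.coe_mul]; noncomm_ring
      rw [e]
      refine (norm_add_le _ _).trans ?_
      rw [CStarRing.norm_coe_unitary_mul]
      push_cast
      linarith
  obtain ⟨h, hh, e⟩ := key n le_rfl
  refine ⟨h, hh, ?_⟩
  rw [Subtype.dist_eq, dist_eq_norm, ← hn]
  refine e.trans_lt ?_
  rcases Nat.eq_zero_or_pos n with rfl | hpos
  · simpa using hε
  · have : (n : ℝ) ≠ 0 := by positivity
    rw [mul_div_cancel₀ _ this]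
    linarith

/-- `exp x exp y = exp (x + y) + o(‖x‖ + ‖y‖)`, as the two sides have the same derivative at `0`. -/
theorem exists_norm_exp_mul_exp_sub_le {c : ℝ} (hc : 0 < c) : ∃ δ > 0, ∀ x y : A, ‖x‖ < δ →
    ‖y‖ < δ → ‖NormedSpace.exp x * NormedSpace.exp y - NormedSpace.exp (x + y)‖ ≤
      c * max ‖x‖ ‖y‖ := by
  have hexp : HasFDerivAt (NormedSpace.exp : A → A) (1 : A →L[ℂ] A) 0 :=
    (hasStrictFDerivAt_exp_zero (𝕂 := ℂ)).hasFDerivAt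
  have h1 : HasFDerivAt (fun p : A × A => NormedSpace.exp p.1)
      (ContinuousLinearMap.fst ℂ A A) 0 := by
    have := HasFDerivAt.comp (0 : A × A) (f := Prod.fst) (g := NormedSpace.exp)
      (by simpa using hexp) hasFDerivAt_fst
    simpa [Function.comp_def] using! this
  have h2 : HasFDerivAt (fun p : A × A => NormedSpace.exp p.2)
      (ContinuousLinearMap.snd ℂ A A) 0 := by
    have := HasFDerivAt.comp (0 : A × A) (f := Prod.snd) (g := NormedSpace.exp)
      (by simpa using hexp) hasFDerivAt_snd
    simpa [Function.comp_def] using! this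
  have h3 : HasFDerivAt (fun p : A × A => NormedSpace.exp (p.1 + p.2))
      (ContinuousLinearMap.fst ℂ A A + ContinuousLinearMap.snd ℂ A A) 0 := by
    have := HasFDerivAt.comp (0 : A × A) (f := fun p : A × A => p.1 + p.2)
      (g := NormedSpace.exp) (by simpa using hexp) (hasFDerivAt_fst.add hasFDerivAt_snd)
    simpa [Function.comp_def] using! this
  have h4 := (h1.mul' h2).sub h3
  have h5 := h4.isLittleO.def hc
  rw [Metric.eventually_nhds_iff] at h5
  obtain ⟨δ, hδ, h6⟩ := h5
  refine ⟨δ, hδ, fun x y hx hy => ?_⟩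
  have h7 := h6 (y := (x, y)) (by simpa [dist_eq_norm, Prod.norm_def] using ⟨hx, hy⟩)
  simpa [Prod.norm_def, add_comm] using h7

/-- The Trotter estimate, uniform for bounded `a` and `b`. -/
theorem exists_norm_expUnitary_mul_sub_le (M : ℝ) {ε : ℝ} (hε : 0 < ε) :
    ∃ n : ℕ, 0 < n ∧ ∀ a b : selfAdjoint A, ‖a‖ ≤ M → ‖b‖ ≤ M →
      ‖(expUnitary ((n : ℝ)⁻¹ • a) * expUnitary ((n : ℝ)⁻¹ • b) : A) -
        expUnitary ((n : ℝ)⁻¹ • (a + b))‖ ≤ ε / n := by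
  obtain ⟨δ, hδ, h⟩ := exists_norm_exp_mul_exp_sub_le (A := A) (c := ε / (|M| + 1)) (by positivity)
  obtain ⟨n, hn⟩ := exists_nat_gt ((|M| + 1) / δ)
  have hn0 : (0 : ℝ) < n := lt_of_le_of_lt (by positivity) hn
  refine ⟨n, by exact_mod_cast hn0, fun a b ha hb => ?_⟩
  have hb' : ∀ c : selfAdjoint A, ‖c‖ ≤ M → ‖Complex.I • (((n : ℝ)⁻¹ • c : selfAdjoint A) : A)‖ ≤
      (|M| + 1) / n := by
    intro c hc
    rw [norm_smul, Complex.norm_I, one_mul, selfAdjoint.val_smul, norm_smul, norm_inv,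
      Real.norm_of_nonneg hn0.le, inv_mul_eq_div]
    have : ‖(c : A)‖ ≤ |M| + 1 := (show ‖(c : A)‖ ≤ M from hc).trans (by linarith [le_abs_self M])
    gcongr
  have hlt : (|M| + 1) / n < δ := by
    rw [div_lt_iff₀ hn0]
    rw [div_lt_iff₀ hδ] at hn
    linarith
  have := h _ _ ((hb' a ha).trans_lt hlt) ((hb' b hb).trans_lt hlt)
  rw [← smul_add, ← AddSubgroup.coe_add, ← smul_add] at this
  refine this.trans ?_
  calc ε / (|M| + 1) * max _ _ ≤ ε / (|M| + 1) * ((|M| + 1) / n) :=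
        mul_le_mul_of_nonneg_left (max_le (hb' a ha) (hb' b hb)) (by positivity)
    _ = ε / n := by
        have : |M| + 1 ≠ 0 := by positivity
        field_simp

theorem expUnitary_add_smul (s t : ℝ) (a : selfAdjoint A) :
    expUnitary ((s + t) • a) = expUnitary (s • a) * expUnitary (t • a) := by
  rw [add_smul]
  refine Commute.expUnitary_add ?_
  rw [selfAdjoint.val_smul, selfAdjoint.val_smul]
  exact ((Commute.refl (a : A)).smul_left s).smul_right t

theorem expUnitary_neg (a : selfAdjoint A) : expUnitary (-a) = (expUnitary a)⁻¹ := by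
  have h := expUnitary_add_smul (-1) 1 a
  rw [neg_add_cancel, zero_smul, expUnitary_zero, neg_smul, one_smul] at h
  exact eq_inv_of_mul_eq_one_left h.symm

/-- Conjugation of a self-adjoint element by a unitary. -/
def conjSA (u : unitary A) : selfAdjoint A →ₗ[ℝ] selfAdjoint A where
  toFun a := ⟨u * a * star (u : A), a.2.conjugate (u : A)⟩
  map_add' a b := by
    ext
    simp [mul_add, add_mul]
  map_smul' t a := by
    ext
    simp

@[simp]
theorem coe_conjSA (u : unitary A) (a : selfAdjoint A) :
    (conjSA u a : A) = u * a * star (u : A) := rfl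

theorem norm_conjSA (u : unitary A) (a : selfAdjoint A) : ‖conjSA u a‖ = ‖a‖ := by
  change ‖(u : A) * a * ((star u : unitary A) : A)‖ = ‖(a : A)‖
  rw [CStarRing.norm_mul_coe_unitary, CStarRing.norm_coe_unitary_mul]

theorem expUnitary_conjSA (u : unitary A) (a : selfAdjoint A) :
    expUnitary (conjSA u a) = u * expUnitary a * u⁻¹ := by
  let +nondep : NormedAlgebra ℚ A := .restrictScalars ℚ ℂ A
  ext
  have h := NormedSpace.exp_units_conj (Unitary.toUnits u) (Complex.I • (a : A))
  simpa [← Unitary.star_eq_inv] using h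

/-- The self-adjoint element `i (x a - a x)`. -/
noncomputable def lieI (x a : selfAdjoint A) : selfAdjoint A :=
  ⟨Complex.I • ⁅(x : A), (a : A)⁆, by
    rw [selfAdjoint.mem_iff, star_smul, star_lie_of_isSelfAdjoint x.2, selfAdjoint.star_val_eq]
    simp⟩

theorem coe_lieI (x a : selfAdjoint A) : (lieI x a : A) = Complex.I • ⁅(x : A), (a : A)⁆ := rfl

/-- The self-adjoint elements `a` for which the one-parameter group `t ↦ exp (i t a)` lies
in `H`. -/
def lieSet (H : Subgroup (unitary A)) : Set (selfAdjoint A) :=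
  {a | ∀ t : ℝ, expUnitary (t • a) ∈ H}

theorem smul_mem_lieSet {H : Subgroup (unitary A)} {a : selfAdjoint A}
    (ha : a ∈ lieSet H) (s : ℝ) : s • a ∈ lieSet H := fun t => by
  rw [smul_smul]
  exact ha _

/-- Lie–Trotter product formula. -/
theorem add_mem_lieSet {H : Subgroup (unitary A)} (hH : IsClosed (H : Set (unitary A)))
    {a b : selfAdjoint A} (h : ∀ t : ℝ, expUnitary (t • a) * expUnitary (t • b) ∈ H) :
    a + b ∈ lieSet H := by
  intro t
  refine mem_of_forall_discrete_path hH fun ε hε => ?_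
  obtain ⟨n, hn, hb⟩ := exists_norm_expUnitary_mul_sub_le (A := A) (max ‖t • a‖ ‖t • b‖) hε
  have hn0 : (n : ℝ) ≠ 0 := by positivity
  refine ⟨n, fun k => expUnitary ((k * (n : ℝ)⁻¹) • t • (a + b)), by simp, ?_, fun k _ => ?_⟩
  · simp only
    rw [mul_inv_cancel₀ hn0, one_smul]
  · refine ⟨_, h ((n : ℝ)⁻¹ * t), ?_⟩
    simp only
    rw [show ((k + 1 : ℕ) : ℝ) * (n : ℝ)⁻¹ = (n : ℝ)⁻¹ + k * (n : ℝ)⁻¹ by push_cast; ring,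
      expUnitary_add_smul, Submonoid.coe_mul, unitary_norm_sub_eq, norm_sub_rev, smul_add]
    have := hb (t • a) (t • b) (le_max_left _ _) (le_max_right _ _)
    simpa only [mul_smul, Submonoid.coe_mul] using this

/-- If the logarithmic derivative `i (a - e^{ita} b e^{-ita})` of the path `t ↦ e^{ita} e^{-itb}`
stays in the Lie algebra of `H`, then the path stays in `H`. -/
theorem expUnitary_mul_inv_mem {H : Subgroup (unitary A)} (hH : IsClosed (H : Set (unitary A)))
    {a b : selfAdjoint A} (h : ∀ t : ℝ, a - conjSA (expUnitary (t • a)) b ∈ lieSet H) :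
    expUnitary a * (expUnitary b)⁻¹ ∈ H := by
  refine mem_of_forall_discrete_path hH fun ε hε => ?_
  obtain ⟨n, hn, hb⟩ := exists_norm_expUnitary_mul_sub_le (A := A) (max ‖a‖ ‖b‖) hε
  have hn0 : (n : ℝ) ≠ 0 := by positivity
  refine ⟨n, fun k => expUnitary ((k * (n : ℝ)⁻¹) • a) * (expUnitary ((k * (n : ℝ)⁻¹) • b))⁻¹,
    by simp, ?_, fun k _ => ?_⟩
  · simp only
    rw [mul_inv_cancel₀ hn0, one_smul, one_smul]
  · set v := expUnitary ((k * (n : ℝ)⁻¹) • a) with hv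
    set w := expUnitary ((k * (n : ℝ)⁻¹) • b) with hw
    refine ⟨_, h (k * (n : ℝ)⁻¹) (n : ℝ)⁻¹, ?_⟩
    have hstep : expUnitary (((k + 1 : ℕ) * (n : ℝ)⁻¹) • a) *
        (expUnitary (((k + 1 : ℕ) * (n : ℝ)⁻¹) • b))⁻¹ =
        (expUnitary ((n : ℝ)⁻¹ • a) * expUnitary ((n : ℝ)⁻¹ • (-conjSA v b))) * (v * w⁻¹) := by
      rw [show ((k + 1 : ℕ) : ℝ) * (n : ℝ)⁻¹ = (n : ℝ)⁻¹ + k * (n : ℝ)⁻¹ by push_cast; ring,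
        expUnitary_add_smul, ← hv, add_comm, expUnitary_add_smul, ← hw, smul_neg, ← map_smul,
        expUnitary_neg, expUnitary_conjSA]
      group
    simp only
    rw [hstep, ← hv, ← hw, Submonoid.coe_mul _ _ (v * w⁻¹), unitary_norm_sub_eq, sub_eq_add_neg a]
    exact hb a (-conjSA v b) (le_max_left _ _)
      (by rw [norm_neg, norm_conjSA]; exact le_max_right _ _)

theorem isClosed_lieSet {H : Subgroup (unitary A)} (hH : IsClosed (H : Set (unitary A))) :
    IsClosed (lieSet H) := by
  have e : lieSet H = ⋂ t : ℝ, (fun a => expUnitary (t • a)) ⁻¹' (H : Set (unitary A)) := by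
    ext a; simp [lieSet]
  rw [e]
  exact isClosed_iInter fun t => hH.preimage (by fun_prop)

/-- The Lie algebra of a closed group of unitaries, as a real space of self-adjoint elements. -/
def lieSubspace (H : Subgroup (unitary A)) (hH : IsClosed (H : Set (unitary A))) :
    Submodule ℝ (selfAdjoint A) where
  carrier := lieSet H
  add_mem' := fun ha hb => add_mem_lieSet hH fun t => H.mul_mem (ha t) (hb t)
  zero_mem' := fun t => by rw [smul_zero, expUnitary_zero]; exact H.one_mem
  smul_mem' := fun s _ ha => smul_mem_lieSet ha s

/-- If the commutators of `u` with `exp (i t a)` are in `H`, then `u a u⋆ - a` is in the Lie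
algebra of `H`. -/
theorem conjSA_sub_mem_lieSet {H : Subgroup (unitary A)} (hH : IsClosed (H : Set (unitary A)))
    {u : unitary A} {a : selfAdjoint A}
    (h : ∀ t : ℝ, u * expUnitary (t • a) * u⁻¹ * (expUnitary (t • a))⁻¹ ∈ H) :
    conjSA u a - a ∈ lieSet H := by
  rw [sub_eq_add_neg]
  refine add_mem_lieSet hH fun t => ?_
  rw [smul_neg, expUnitary_neg, ← map_smul, expUnitary_conjSA]
  exact h t

theorem hasDerivAt_expUnitary (x : selfAdjoint A) :
    HasDerivAt (fun s : ℝ => (expUnitary (s • x) : A)) (Complex.I • (x : A)) 0 := by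
  have h := hasDerivAt_exp_smul_const (𝕂 := ℝ) (Complex.I • (x : A)) 0
  simpa [smul_comm Complex.I] using h

theorem hasDerivAt_conj_expUnitary (x : selfAdjoint A) (a : A) :
    HasDerivAt (fun s : ℝ => (expUnitary (s • x) : A) * a * star (expUnitary (s • x) : A))
      (Complex.I • ⁅(x : A), a⁆) 0 := by
  have h1 := hasDerivAt_expUnitary x
  have h2 := (h1.mul_const a).fun_mul h1.star
  refine h2.congr_deriv ?_
  simp [Ring.lie_def, sub_eq_add_neg]

/-- Differentiation of `s ↦ e^{isx} a e^{-isx}` at `s = 0`. -/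
theorem lieI_mem_of_conjSA_sub_mem {L : Submodule ℝ (selfAdjoint A)}
    (hL : IsClosed (L : Set (selfAdjoint A))) {x a : selfAdjoint A}
    (h : ∀ s : ℝ, conjSA (expUnitary (s • x)) a - a ∈ L) : lieI x a ∈ L := by
  have h1 := (hasDerivAt_conj_expUnitary x (a : A)).tendsto_slope_zero
  have h2 : Tendsto (fun t : ℝ => t⁻¹ • (conjSA (expUnitary (t • x)) a - a)) (𝓝[≠] 0)
      (𝓝 (lieI x a)) := by
    rw [tendsto_subtype_rng]
    simpa using! h1
  exact hL.mem_of_tendsto h2 (Eventually.of_forall fun t => L.smul_mem _ (h t))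

end OneParameterSubgroups

/-! ### Complexified Lie algebras -/

section Complexification

variable {A : Type*} [CStarAlgebra A]

/-- The complex subspace `L + iL` of `A` spanned by a real space `L` of self-adjoint elements. -/
def complexify (L : Submodule ℝ (selfAdjoint A)) : Submodule ℂ A where
  carrier := {z | realPart z ∈ L ∧ imaginaryPart z ∈ L}
  add_mem' := fun hz hw => by
    simp only [Set.mem_ofPred_eq, map_add]
    exact ⟨L.add_mem hz.1 hw.1, L.add_mem hz.2 hw.2⟩
  zero_mem' := by simp
  smul_mem' := fun c z hz => by
    simp only [Set.mem_ofPred_eq, realPart_smul, imaginaryPart_smul]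
    exact ⟨L.sub_mem (L.smul_mem _ hz.1) (L.smul_mem _ hz.2),
      L.add_mem (L.smul_mem _ hz.2) (L.smul_mem _ hz.1)⟩

theorem mem_complexify {L : Submodule ℝ (selfAdjoint A)} {z : A} :
    z ∈ complexify L ↔ realPart z ∈ L ∧ imaginaryPart z ∈ L := Iff.rfl

theorem coe_mem_complexify {L : Submodule ℝ (selfAdjoint A)} {a : selfAdjoint A} :
    (a : A) ∈ complexify L ↔ a ∈ L := by
  simp [mem_complexify]

theorem star_mem_complexify {L : Submodule ℝ (selfAdjoint A)} {z : A} (hz : z ∈ complexify L) :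
    star z ∈ complexify L := by
  have e : star z = ((realPart z : selfAdjoint A) : A) -
      Complex.I • ((imaginaryPart z : selfAdjoint A) : A) := by
    conv_lhs => rw [← realPart_add_I_smul_imaginaryPart z]
    simp [sub_eq_add_neg]
  rw [e]
  exact Submodule.sub_mem _ (coe_mem_complexify.2 hz.1)
    (Submodule.smul_mem _ _ (coe_mem_complexify.2 hz.2))

theorem isClosed_complexify {L : Submodule ℝ (selfAdjoint A)}
    (hL : IsClosed (L : Set (selfAdjoint A))) : IsClosed (complexify L : Set A) := by
  have h1 : Continuous fun z : A => (realPart z : selfAdjoint A) := by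
    refine continuous_induced_rng.2 ?_
    simp only [Function.comp_def, realPart_apply_coe]
    fun_prop
  have h2 : Continuous fun z : A => (imaginaryPart z : selfAdjoint A) := by
    refine continuous_induced_rng.2 ?_
    simp only [Function.comp_def, imaginaryPart_apply_coe]
    fun_prop
  exact (hL.preimage h1).inter (hL.preimage h2)

theorem lie_mem_complexify {L₁ L₂ L₃ : Submodule ℝ (selfAdjoint A)}
    (h : ∀ x ∈ L₁, ∀ y ∈ L₂, lieI x y ∈ L₃) {z w : A} (hz : z ∈ complexify L₁)
    (hw : w ∈ complexify L₂) : ⁅z, w⁆ ∈ complexify L₃ := by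
  have key : ∀ x ∈ L₁, ∀ y ∈ L₂, ⁅(x : A), (y : A)⁆ ∈ complexify L₃ := by
    intro x hx y hy
    have e : ⁅(x : A), (y : A)⁆ = (-Complex.I) • (lieI x y : A) := by
      rw [coe_lieI, smul_smul, neg_mul, Complex.I_mul_I, neg_neg, one_smul]
    rw [e]
    exact Submodule.smul_mem _ _ (coe_mem_complexify.2 (h x hx y hy))
  have e : ⁅z, w⁆ = (⁅(realPart z : A), (realPart w : A)⁆ -
      ⁅(imaginaryPart z : A), (imaginaryPart w : A)⁆) +
      Complex.I • (⁅(realPart z : A), (imaginaryPart w : A)⁆ +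
        ⁅(imaginaryPart z : A), (realPart w : A)⁆) := by
    conv_lhs => rw [← realPart_add_I_smul_imaginaryPart z, ← realPart_add_I_smul_imaginaryPart w]
    simp only [Ring.lie_def, add_mul, mul_add, smul_mul_assoc, mul_smul_comm, smul_smul,
      Complex.I_mul_I, neg_smul, one_smul, smul_sub, smul_add]
    abel
  rw [e]
  exact Submodule.add_mem _ (Submodule.sub_mem _ (key _ hz.1 _ hw.1) (key _ hz.2 _ hw.2))
    (Submodule.smul_mem _ _ (Submodule.add_mem _ (key _ hz.1 _ hw.2) (key _ hz.2 _ hw.1)))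

/-- The self-adjoint part of an ideal. -/
def idealSA (I : TwoSidedIdeal A) : Submodule ℝ (selfAdjoint A) where
  carrier := {a | (a : A) ∈ I}
  add_mem' := fun ha hb => I.add_mem ha hb
  zero_mem' := I.zero_mem
  smul_mem' := fun t a ha => by
    change ((t • a : selfAdjoint A) : A) ∈ I
    rw [selfAdjoint.val_smul, ← Complex.coe_smul]
    exact ideal_smul_mem I _ ha

theorem mem_complexify_idealSA {I : TwoSidedIdeal A} (hI : IsClosed (I : Set A)) {z : A}
    (hz : z ∈ I) : z ∈ complexify (idealSA I) := by
  have hs := star_mem_ideal hI hz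
  constructor
  · change ((realPart z : selfAdjoint A) : A) ∈ I
    rw [realPart_apply_coe, ← Complex.coe_smul]
    exact ideal_smul_mem I _ (I.add_mem hz hs)
  · change ((imaginaryPart z : selfAdjoint A) : A) ∈ I
    rw [imaginaryPart_apply_coe, ← Complex.coe_smul]
    exact ideal_smul_mem I _ (ideal_smul_mem I _ (I.sub_mem hz hs))

end Complexification

/-! ### The groups `U`, `CU` and their ideal versions -/

section UnitaryGroupStructure

open selfAdjoint
open scoped commutatorElement

variable {A : Type*} [CStarAlgebra A]

theorem expUnitary_mem_U (a : selfAdjoint A) : expUnitary a ∈ U A :=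
  pathComponent_subset_component _ (joined_one_expUnitary a)

/-- Every element of `U A` is a finite product of exponentials. -/
theorem exists_list_prod_eq_of_mem_U {u : unitary A} (hu : u ∈ U A) :
    ∃ l : List (selfAdjoint A), (l.map expUnitary).prod = u := by
  rw [← Unitary.mem_pathComponentOne_iff, pathComponent_eq_connectedComponent]
  exact hu

theorem continuous_conj {G : Type*} [Group G] [TopologicalSpace G] [IsTopologicalGroup G] (g : G) :
    Continuous fun h : G => g * h * g⁻¹ := by fun_prop

instance normal_U : (U A).Normal where
  conj_mem n hn g := by
    have h := (continuous_conj g).image_connectedComponent_subset 1 ⟨n, hn, rfl⟩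
    simpa using! h

theorem isClosed_U : IsClosed (U A : Set (unitary A)) := isClosed_connectedComponent

theorem sub_one_mem_of_mem_UIdeal {I : TwoSidedIdeal A} {u : unitary A} (hu : u ∈ UIdeal I) :
    (u : A) - 1 ∈ I := by
  obtain ⟨v, -, rfl⟩ := hu
  exact v.2

theorem UIdeal_le_U (I : TwoSidedIdeal A) : UIdeal I ≤ U A := by
  rintro _ ⟨v, hv, rfl⟩
  have h := (continuous_subtype_val (p := (· ∈ unitaryOfIdeal I))).image_connectedComponent_subset 1
    ⟨v, hv, rfl⟩
  exact h

instance normal_UIdeal (I : TwoSidedIdeal A) : (UIdeal I).Normal where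
  conj_mem := by
    rintro _ ⟨v, hv, rfl⟩ g
    have hmem : ∀ w : unitaryOfIdeal I, g * w * g⁻¹ ∈ unitaryOfIdeal I := by
      intro w
      have e : ((g * w * g⁻¹ : unitary A) : A) - 1 =
          (g : A) * (((w : unitary A) : A) - 1) * ((g⁻¹ : unitary A) : A) := by
        have h : (g : A) * ((g⁻¹ : unitary A) : A) = 1 := by
          rw [← Submonoid.coe_mul, mul_inv_cancel, Submonoid.coe_one]
        rw [mul_sub, sub_mul, mul_one, h]
        rfl
      change ((g * w * g⁻¹ : unitary A) : A) - 1 ∈ I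
      rw [e]
      exact I.mul_mem_right _ _ (I.mul_mem_left _ _ w.2)
    have hc : Continuous fun w : unitaryOfIdeal I => (⟨g * w * g⁻¹, hmem w⟩ : unitaryOfIdeal I) :=
      ((continuous_conj g).comp continuous_subtype_val).subtype_mk _
    have h := hc.image_connectedComponent_subset 1 ⟨v, hv, rfl⟩
    refine ⟨⟨g * v * g⁻¹, hmem v⟩, ?_, rfl⟩
    have e1 : (⟨g * (1 : unitaryOfIdeal I) * g⁻¹, hmem 1⟩ : unitaryOfIdeal I) = 1 := by
      ext1
      simp
    rw [e1] at h
    exact h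

theorem exp_sub_one_mem {I : TwoSidedIdeal A} (hI : IsClosed (I : Set A)) {x : A} (hx : x ∈ I) :
    NormedSpace.exp x - 1 ∈ I := by
  have h := (hasSum_nat_add_iff' 1).2 (NormedSpace.exp_series_hasSum_exp' (𝕂 := ℂ) x)
  simp only [Finset.range_one, Finset.sum_singleton, Nat.factorial_zero, Nat.cast_one, inv_one,
    pow_zero, one_smul] at h
  refine hI.mem_of_tendsto h (Filter.Eventually.of_forall fun s => ?_)
  refine sum_mem fun n _ => ideal_smul_mem I _ ?_
  rw [pow_succ]
  exact I.mul_mem_left _ _ hx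

theorem expUnitary_mem_UIdeal {I : TwoSidedIdeal A} (hI : IsClosed (I : Set A))
    {a : selfAdjoint A} (ha : (a : A) ∈ I) : expUnitary a ∈ UIdeal I := by
  have hmem : ∀ t : ℝ, expUnitary (t • a) ∈ unitaryOfIdeal I := by
    intro t
    refine exp_sub_one_mem hI (ideal_smul_mem I _ ?_)
    exact (idealSA I).smul_mem t ha
  have hj : Joined (1 : unitaryOfIdeal I) ⟨expUnitary ((1 : ℝ) • a), hmem 1⟩ :=
    ⟨{ toFun := fun t => ⟨expUnitary ((t : ℝ) • a), hmem t⟩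
       continuous_toFun := by
        refine Continuous.subtype_mk ?_ _
        fun_prop
       source' := by ext1; simp
       target' := by ext1; simp }⟩
  refine ⟨_, pathComponent_subset_component _ hj, ?_⟩
  simp

theorem isClosed_closedCommutator (H : Subgroup (unitary A)) :
    IsClosed (closedCommutator H : Set (unitary A)) :=
  Subgroup.isClosed_topologicalClosure _

instance normal_closedCommutator (H : Subgroup (unitary A)) [H.Normal] :
    (closedCommutator H).Normal :=
  Subgroup.is_normal_topologicalClosure _

theorem commutatorElement_mem_closedCommutator {H : Subgroup (unitary A)} {u v : unitary A}
    (hu : u ∈ H) (hv : v ∈ H) : ⁅u, v⁆ ∈ closedCommutator H :=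
  Subgroup.le_topologicalClosure _ (Subgroup.commutator_mem_commutator hu hv)

instance normal_CUIdeal (I : TwoSidedIdeal A) : (CUIdeal I).Normal := normal_closedCommutator _

theorem isClosed_CU : IsClosed (CU A : Set (unitary A)) := isClosed_closedCommutator _

theorem isClosed_CUIdeal (I : TwoSidedIdeal A) : IsClosed (CUIdeal I : Set (unitary A)) :=
  isClosed_closedCommutator _

theorem CUIdeal_le_CU (I : TwoSidedIdeal A) : CUIdeal I ≤ CU A :=
  Subgroup.topologicalClosure_mono (Subgroup.commutator_mono (UIdeal_le_U I) (UIdeal_le_U I))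

theorem CU_le_U : CU A ≤ U A :=
  Subgroup.topologicalClosure_minimal _ (Subgroup.commutator_le_right _ _) isClosed_U

/-- The complexified Lie algebra of `CUIdeal I` contains `[I, I]`. -/
theorem lie_mem_CUIdeal {I : TwoSidedIdeal A} (hI : IsClosed (I : Set A)) {a b : A} (ha : a ∈ I)
    (hb : b ∈ I) : ⁅a, b⁆ ∈ complexify (lieSubspace (CUIdeal I) (isClosed_CUIdeal I)) := by
  refine lie_mem_complexify (fun x hx y hy => ?_) (mem_complexify_idealSA hI ha)
    (mem_complexify_idealSA hI hb)
  refine lieI_mem_of_conjSA_sub_mem (isClosed_lieSet (isClosed_CUIdeal I)) fun s => ?_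
  refine conjSA_sub_mem_lieSet (isClosed_CUIdeal I) fun t => ?_
  exact commutatorElement_mem_closedCommutator
    (expUnitary_mem_UIdeal hI ((idealSA I).smul_mem s hx))
    (expUnitary_mem_UIdeal hI ((idealSA I).smul_mem t hy))

theorem conjSA_sub_mem_lieSet_CU {u : unitary A} (hu : u ∈ U A) (a : selfAdjoint A) :
    conjSA u a - a ∈ lieSet (CU A) :=
  conjSA_sub_mem_lieSet isClosed_CU fun _ =>
    commutatorElement_mem_closedCommutator hu (expUnitary_mem_U _)

theorem lieI_mem_lieSet_CU (x a : selfAdjoint A) : lieI x a ∈ lieSet (CU A) :=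
  lieI_mem_of_conjSA_sub_mem (L := lieSubspace _ isClosed_CU) (isClosed_lieSet isClosed_CU)
    fun _ => conjSA_sub_mem_lieSet_CU (expUnitary_mem_U _) a

/-- The complexified Lie algebra of `CU A` contains `[A, A]`. -/
theorem lie_mem_CU (a b : A) : ⁅a, b⁆ ∈ complexify (lieSubspace (CU A) isClosed_CU) :=
  lie_mem_complexify (L₁ := ⊤) (L₂ := ⊤) (fun x _ y _ => lieI_mem_lieSet_CU x y)
    ⟨trivial, trivial⟩ ⟨trivial, trivial⟩

/-- If `G` normalizes the closed group `H`, then `h a h⋆ - a` is in the Lie algebra of `H` for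
`h ∈ H` and `a` in the Lie algebra of `G`. -/
theorem conjSA_sub_mem_of_normalizes {H G : Subgroup (unitary A)}
    (hH : IsClosed (H : Set (unitary A))) (hG : ∀ g ∈ G, ∀ h ∈ H, g * h * g⁻¹ ∈ H)
    {h : unitary A} (hh : h ∈ H) {a : selfAdjoint A} (ha : a ∈ lieSet G) :
    conjSA h a - a ∈ lieSet H := by
  refine conjSA_sub_mem_lieSet hH fun t => ?_
  have := H.mul_mem hh (hG _ (ha t) _ (H.inv_mem hh))
  simpa only [mul_assoc] using this

theorem lieI_mem_of_normalizes {H G : Subgroup (unitary A)}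
    (hH : IsClosed (H : Set (unitary A))) (hG : ∀ g ∈ G, ∀ h ∈ H, g * h * g⁻¹ ∈ H)
    {x a : selfAdjoint A} (hx : x ∈ lieSet H) (ha : a ∈ lieSet G) : lieI x a ∈ lieSet H :=
  lieI_mem_of_conjSA_sub_mem (L := lieSubspace H hH) (isClosed_lieSet hH) fun s =>
    conjSA_sub_mem_of_normalizes hH hG (hx s) ha

/-- The complexified Lie algebra of a closed group of unitaries normalized by `CU A`. -/
theorem isLieSubspace_complexify {H : Subgroup (unitary A)}
    (hH : IsClosed (H : Set (unitary A))) (hn : ∀ g ∈ CU A, ∀ h ∈ H, g * h * g⁻¹ ∈ H) :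
    IsLieSubspace (complexify (lieSubspace H hH)) where
  normalized _ hx a b :=
    lie_mem_complexify (fun _ hx _ hy => lieI_mem_of_normalizes hH hn hx hy) hx (lie_mem_CU a b)
  star_mem _ hx := star_mem_complexify hx
  lie_mem _ hx _ hy := lie_mem_complexify (fun _ hx _ hy => lieI_mem_of_normalizes hH
    (fun _ hg _ hh => H.mul_mem (H.mul_mem hg hh) (H.inv_mem hg)) hx hy) hx hy

/-- A closed group of unitaries whose complexified Lie algebra contains `[A, A]` contains the
commutators of all unitaries `u ∈ U A` and `v`. -/
theorem commutatorElement_mem_of_lie_mem {H : Subgroup (unitary A)}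
    (hH : IsClosed (H : Set (unitary A))) (h : ∀ a b : A, ⁅a, b⁆ ∈ complexify (lieSubspace H hH))
    {u : unitary A} (hu : u ∈ U A) (v : unitary A) : ⁅u, v⁆ ∈ H := by
  have hexp : ∀ (a : selfAdjoint A) (v : unitary A), ⁅expUnitary a, v⁆ ∈ H := by
    intro a v
    have e : ⁅expUnitary a, v⁆ = expUnitary a * (expUnitary (conjSA v a))⁻¹ := by
      rw [expUnitary_conjSA, commutatorElement_def]; group
    rw [e]
    refine expUnitary_mul_inv_mem hH fun t => ?_
    have hmem : ((a - conjSA (expUnitary (t • a)) (conjSA v a) : selfAdjoint A) : A) ∈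
        complexify (lieSubspace H hH) := by
      set w : unitary A := expUnitary (t • a) * v with hw
      -- `a - w a w⋆ = ⁅a w⋆, w⁆`
      have e : ((a - conjSA (expUnitary (t • a)) (conjSA v a) : selfAdjoint A) : A) =
          ⁅(a : A) * star (w : A), (w : A)⁆ := by
        have h1 : star (w : A) * (w : A) = 1 := Unitary.coe_star_mul_self w
        rw [Ring.lie_def, mul_assoc, h1, mul_one, ← mul_assoc, AddSubgroup.coe_sub, coe_conjSA,
          coe_conjSA, hw, Submonoid.coe_mul, star_mul]
        simp only [mul_assoc]
      rw [e]
      exact h _ _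
    exact coe_mem_complexify.1 hmem
  obtain ⟨l, rfl⟩ := exists_list_prod_eq_of_mem_U hu
  have key : ∀ w v : unitary A, w * ⁅(l.map expUnitary).prod, v⁆ * w⁻¹ ∈ H := by
    clear hu
    induction l with
    | nil => intro w v; simp [commutatorElement_def]
    | cons a l ih =>
      intro w v
      have e : w * ⁅(List.map expUnitary (a :: l)).prod, v⁆ * w⁻¹ =
          ((w * expUnitary a) * ⁅(List.map expUnitary l).prod, v⁆ * (w * expUnitary a)⁻¹) *
            ⁅expUnitary (conjSA w a), w * v * w⁻¹⁆ := by
        rw [expUnitary_conjSA, List.map_cons, List.prod_cons]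
        simp only [commutatorElement_def]
        group
      rw [e]
      exact H.mul_mem (ih _ _) (hexp _ _)
  simpa using key 1 v

theorem CU_le_of_lie_mem {H : Subgroup (unitary A)}
    (hH : IsClosed (H : Set (unitary A)))
    (h : ∀ a b : A, ⁅a, b⁆ ∈ complexify (lieSubspace H hH)) : CU A ≤ H :=
  Subgroup.topologicalClosure_minimal _
    (Subgroup.commutator_le.2 fun _ hu v _ => commutatorElement_mem_of_lie_mem hH h hu v) hH

end UnitaryGroupStructure

/-! ### Positive and tracial functionals -/

section PositiveFunctionals

variable {A : Type*} [CStarAlgebra A] [PartialOrder A] [StarOrderedRing A]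

/-- Positivity of a real functional on a C⋆-algebra. -/
def IsPositiveFunctional (p : A →ₗ[ℝ] ℝ) : Prop := ∀ x, 0 ≤ x → 0 ≤ p x

theorem IsPositiveFunctional.mono {p : A →ₗ[ℝ] ℝ} (hp : IsPositiveFunctional p) {x y : A}
    (h : x ≤ y) : p x ≤ p y := by
  have := hp _ (sub_nonneg.2 h)
  rw [map_sub] at this
  linarith

/-- Every bounded real functional is a difference of positive functionals: by Riesz extension
there is a positive `p` with `φ ≤ p` on positive elements. -/
theorem exists_positive_sub_positive (φ : A →L[ℝ] ℝ) : ∃ p q : A →ₗ[ℝ] ℝ,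
    IsPositiveFunctional p ∧ IsPositiveFunctional q ∧ ∀ x, φ x = p x - q x := by
  -- the cone of those `(z, r)` on which `p z + r` is forced to be nonnegative
  let s : PointedCone ℝ (A × ℝ) :=
    { carrier := {w | ∃ x y : A, 0 ≤ x ∧ 0 ≤ y ∧ ‖φ‖ * ‖w.1 - x - y‖ ≤ w.2 + φ y}
      add_mem' := by
        rintro w w' ⟨x, y, hx, hy, h⟩ ⟨x', y', hx', hy', h'⟩
        refine ⟨x + x', y + y', add_nonneg hx hx', add_nonneg hy hy', ?_⟩
        have e : (w + w').1 - (x + x') - (y + y') = (w.1 - x - y) + (w'.1 - x' - y') := by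
          rw [Prod.fst_add]; abel
        rw [e, Prod.snd_add, map_add]
        have h1 := mul_le_mul_of_nonneg_left (norm_add_le (w.1 - x - y) (w'.1 - x' - y'))
          (norm_nonneg φ)
        linarith
      zero_mem' := ⟨0, 0, le_rfl, le_rfl, by simp⟩
      smul_mem' := by
        rintro c w ⟨x, y, hx, hy, h⟩
        refine ⟨(c : ℝ) • x, (c : ℝ) • y, smul_nonneg c.2 hx, smul_nonneg c.2 hy, ?_⟩
        have e : (c • w).1 - (c : ℝ) • x - (c : ℝ) • y = (c : ℝ) • (w.1 - x - y) := by
          rw [smul_sub, smul_sub]; rfl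
        have e2 : (c • w).2 = (c : ℝ) * w.2 := rfl
        rw [e, e2, map_smul, norm_smul, Real.norm_of_nonneg c.2, smul_eq_mul]
        have := mul_le_mul_of_nonneg_left h c.2
        linarith }
  -- prescribe the functional to be `(0, r) ↦ r`
  let f : (A × ℝ) →ₗ.[ℝ] ℝ :=
    { domain := LinearMap.range (LinearMap.inr ℝ A ℝ)
      toFun := (LinearMap.snd ℝ A ℝ).comp (Submodule.subtype _) }
  obtain ⟨g, hgf, hgs⟩ := riesz_extension s f (by
      rintro ⟨_, c, rfl⟩ ⟨x, y, hx, hy, h⟩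
      change 0 ≤ c
      have h1 : ‖y‖ ≤ ‖x + y‖ := CStarAlgebra.norm_le_norm_of_nonneg_of_le hy (by simpa using hx)
      have h2 : φ y ≤ ‖φ‖ * ‖y‖ := (le_abs_self _).trans (φ.le_opNorm y)
      have h3 : ‖φ‖ * ‖0 - x - y‖ ≤ c + φ y := h
      rw [zero_sub, ← neg_add', norm_neg] at h3
      linarith [mul_le_mul_of_nonneg_left h1 (norm_nonneg φ)]) (by
      rintro ⟨z, r⟩
      exact ⟨⟨_, ‖φ‖ * ‖z‖ - r, rfl⟩, 0, 0, le_rfl, le_rfl, by simp⟩)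
  have hg1 : ∀ c : ℝ, g (0, c) = c := fun c => hgf ⟨_, c, rfl⟩
  refine ⟨g.comp (LinearMap.inl ℝ A ℝ), g.comp (LinearMap.inl ℝ A ℝ) - φ.toLinearMap, ?_, ?_, ?_⟩
  · intro x hx
    exact hgs (x, 0) ⟨x, 0, hx, le_rfl, by simp⟩
  · intro y hy
    have h := hgs (y, -φ y) ⟨0, y, le_rfl, hy, by simp⟩
    have e : ((y, -φ y) : A × ℝ) = (y, 0) + (0, -φ y) := by simp
    rw [e, map_add, hg1] at h
    simpa [sub_eq_add_neg] using! h
  · intro x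
    simp

/-- The Cauchy–Schwarz inequality for `p` with one of the two vectors equal to `1`. -/
theorem IsPositiveFunctional.sq_le {p : A →ₗ[ℝ] ℝ} (hp : IsPositiveFunctional p) (x : A) :
    p (x + star x) ^ 2 ≤ 4 * p 1 * p (star x * x) := by
  have h : ∀ t : ℝ, 0 ≤ p 1 * (t * t) + (-p (x + star x)) * t + p (star x * x) := by
    intro t
    have h1 := hp _ (star_mul_self_nonneg (x - t • (1 : A)))
    have e : star (x - t • (1 : A)) * (x - t • (1 : A)) =
        star x * x - t • (x + star x) + (t * t) • (1 : A) := by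
      simp only [star_sub, star_smul, star_one, sub_mul, mul_sub, smul_mul_assoc, mul_smul_comm,
        one_mul, mul_one, smul_smul, smul_add, smul_sub, star_trivial]
      abel
    rw [e, map_add, map_sub, map_smul, map_smul, smul_eq_mul, smul_eq_mul] at h1
    linarith
  have := discrim_le_zero h
  rw [discrim] at this
  nlinarith

theorem conj_nonneg_of_isSelfAdjoint {x c : A} (hx : 0 ≤ x) (hc : IsSelfAdjoint c) :
    0 ≤ c * x * c := by
  simpa [hc.star_eq] using star_left_conjugate_nonneg hx c

theorem mul_self_le_self {a : A} (h0 : 0 ≤ a) (h1 : a ≤ 1) : a * a ≤ a := by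
  have hsa : IsSelfAdjoint a := IsSelfAdjoint.of_nonneg h0
  have hsa' : IsSelfAdjoint (1 - a) := (IsSelfAdjoint.one A).sub hsa
  have h2 := add_nonneg (conj_nonneg_of_isSelfAdjoint (sub_nonneg.2 h1) hsa)
    (conj_nonneg_of_isSelfAdjoint h0 hsa')
  rw [← sub_nonneg]
  convert h2 using 1
  noncomm_ring

/-- If the positive contractions `a` and `b` almost dominate each other with respect to `p`,
then they almost agree under `p`. -/
theorem IsPositiveFunctional.sq_sub_le {p : A →ₗ[ℝ] ℝ} (hp : IsPositiveFunctional p) {K η : ℝ}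
    (hK : p 1 ≤ K) {a b : A} (ha0 : 0 ≤ a) (ha1 : a ≤ 1) (hb0 : 0 ≤ b)
    (hb1 : b ≤ 1) (hab : p ((1 - a) * b * (1 - a)) ≤ η) (hba : p ((1 - b) * a * (1 - b)) ≤ η) :
    p (a - b) ^ 2 ≤ 2 * K * √(K * η) := by
  have hasa : IsSelfAdjoint a := IsSelfAdjoint.of_nonneg ha0
  have hbsa : IsSelfAdjoint b := IsSelfAdjoint.of_nonneg hb0
  have hp1 : 0 ≤ p 1 := hp _ zero_le_one
  have hK0 : 0 ≤ K := hp1.trans hK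
  have aux : ∀ c d : A, IsSelfAdjoint c → IsSelfAdjoint d → 0 ≤ d → d ≤ 1 →
      p ((1 - c) * d * (1 - c)) ≤ η → p (d * (1 - c) + star (d * (1 - c))) ≤ 2 * √(K * η) := by
    intro c d hc hd hd0 hd1 h
    have hc' : IsSelfAdjoint (1 - c) := (IsSelfAdjoint.one A).sub hc
    have h1 : star (d * (1 - c)) * (d * (1 - c)) ≤ (1 - c) * d * (1 - c) := by
      have h2 := conj_nonneg_of_isSelfAdjoint (sub_nonneg.2 (mul_self_le_self hd0 hd1)) hc'
      rw [← sub_nonneg, star_mul, hc'.star_eq, hd.star_eq]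
      convert h2 using 1
      noncomm_ring
    have h2 := hp.sq_le (d * (1 - c))
    have h3 : p (star (d * (1 - c)) * (d * (1 - c))) ≤ η := (hp.mono h1).trans h
    have h4 : 0 ≤ p (star (d * (1 - c)) * (d * (1 - c))) := hp _ (star_mul_self_nonneg _)
    have h5 : (p (d * (1 - c) + star (d * (1 - c)))) ^ 2 ≤ 4 * (K * η) := by
      refine h2.trans ?_
      rw [mul_assoc]
      have := mul_le_mul hK h3 h4 hK0
      linarith
    have h6 := Real.le_sqrt_of_sq_le h5
    rwa [Real.sqrt_mul (by norm_num), show (4 : ℝ) = 2 ^ 2 by norm_num,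
      Real.sqrt_sq (by norm_num)] at h6
  have h1 := aux a b hasa hbsa hb0 hb1 hab
  have h2 := aux b a hbsa hasa ha0 ha1 hba
  have h3 : p ((a - b) * (a - b)) ≤ 2 * √(K * η) := by
    have e : (2 : ℝ) • ((a - b) * (a - b)) = (b * (1 - a) + star (b * (1 - a))) +
        (a * (1 - b) + star (a * (1 - b))) - (2 : ℝ) • (a - a * a) - (2 : ℝ) • (b - b * b) := by
      simp only [star_mul, star_sub, star_one, hasa.star_eq, hbsa.star_eq, two_smul]
      noncomm_ring
    have e2 := congrArg p e
    rw [map_smul, map_sub, map_sub, map_add, map_smul, map_smul] at e2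
    simp only [smul_eq_mul] at e2
    have h4 := hp _ (sub_nonneg.2 (mul_self_le_self ha0 ha1))
    have h5 := hp _ (sub_nonneg.2 (mul_self_le_self hb0 hb1))
    linarith
  have h4 := hp.sq_le (a - b)
  have hs : star (a - b) = a - b := (hasa.sub hbsa).star_eq
  rw [hs, map_add] at h4
  have h5 : 0 ≤ p ((a - b) * (a - b)) := by
    have := star_mul_self_nonneg (a - b)
    rw [hs] at this
    exact hp _ this
  have := mul_le_mul hK h3 h5 hK0
  nlinarith

/-- The positive contraction `a + (1 - a) b (1 - a)`, an upper bound of `a`, as a substitute for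
the supremum of `a` and `b`. -/
theorem join_mem {a b : A} (ha0 : 0 ≤ a) (ha1 : a ≤ 1) (hb0 : 0 ≤ b) (hb1 : b ≤ 1) :
    0 ≤ a + (1 - a) * b * (1 - a) ∧ a + (1 - a) * b * (1 - a) ≤ 1 := by
  have hasa : IsSelfAdjoint a := IsSelfAdjoint.of_nonneg ha0
  have hsa' : IsSelfAdjoint (1 - a) := (IsSelfAdjoint.one A).sub hasa
  refine ⟨add_nonneg ha0 (conj_nonneg_of_isSelfAdjoint hb0 hsa'), ?_⟩
  have h1 := conj_nonneg_of_isSelfAdjoint (sub_nonneg.2 hb1) hsa'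
  have h2 := add_nonneg h1 (sub_nonneg.2 (mul_self_le_self ha0 ha1))
  rw [← sub_nonneg]
  convert h2 using 1
  noncomm_ring

/-- For a tracial functional the join `a + (1 - a) b (1 - a)` has a complementary meet
`√b (2a - a²) √b`. -/
theorem exists_meet {g : A →L[ℝ] ℝ} (hg : ∀ y, g (star y * y) = g (y * star y)) {a b : A}
    (ha0 : 0 ≤ a) (ha1 : a ≤ 1) (hb0 : 0 ≤ b) (hb1 : b ≤ 1) :
    ∃ d, 0 ≤ d ∧ d ≤ 1 ∧ g (a + (1 - a) * b * (1 - a)) + g d = g a + g b := by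
  have hasa : IsSelfAdjoint a := IsSelfAdjoint.of_nonneg ha0
  have hsa' : IsSelfAdjoint (1 - a) := (IsSelfAdjoint.one A).sub hasa
  set r : A := CFC.sqrt b with hr
  have hrr : r * r = b := CFC.sqrt_mul_sqrt_self b hb0
  have hrsa : IsSelfAdjoint r := IsSelfAdjoint.of_nonneg (CFC.sqrt_nonneg b)
  have hm0 : 0 ≤ a + (a - a * a) := add_nonneg ha0 (sub_nonneg.2 (mul_self_le_self ha0 ha1))
  have hm1 : 0 ≤ (1 - a) * 1 * (1 - a) := conj_nonneg_of_isSelfAdjoint zero_le_one hsa'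
  refine ⟨r * (a + (a - a * a)) * r, conj_nonneg_of_isSelfAdjoint hm0 hrsa, ?_, ?_⟩
  · refine le_trans ?_ hb1
    rw [← sub_nonneg]
    convert conj_nonneg_of_isSelfAdjoint hm1 hrsa using 1
    rw [← hrr]
    noncomm_ring
  · have h := hg (r * (1 - a))
    rw [star_mul, hsa'.star_eq, hrsa.star_eq] at h
    have e1 : (1 - a) * r * (r * (1 - a)) = (1 - a) * b * (1 - a) := by
      rw [← hrr]; noncomm_ring
    have e2 : r * (1 - a) * ((1 - a) * r) = b - r * (a + (a - a * a)) * r := by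
      rw [← hrr]; noncomm_ring
    rw [e1, e2, map_sub] at h
    rw [map_add, h]
    ring

/-- Given a tracial functional `g` and a positive functional `F`, choose `a` almost maximizing `g`
among positive contractions and then, among those, almost maximizing `F`. If `g b = g a`, then the
join of `a` and `b` still almost maximizes `g`, so `F` gains almost nothing from it. -/
theorem exists_almost_maximal (g : A →L[ℝ] ℝ) (hg : ∀ y, g (star y * y) = g (y * star y))
    {F : A →ₗ[ℝ] ℝ} (hF : IsPositiveFunctional F) {ε η : ℝ} (hε : 0 < ε) (hη : 0 < η) :
    ∃ a, 0 ≤ a ∧ a ≤ 1 ∧ (∀ y, 0 ≤ y → y ≤ 1 → g y ≤ g a + ε) ∧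
      ∀ b, 0 ≤ b → b ≤ 1 → g b = g a → F ((1 - a) * b * (1 - a)) ≤ η := by
  set W : Set A := {y | 0 ≤ y ∧ y ≤ 1} with hW
  have hWne : W.Nonempty := ⟨0, le_rfl, zero_le_one⟩
  have hnorm : ∀ y ∈ W, ‖y‖ ≤ ‖(1 : A)‖ := fun y hy =>
    CStarAlgebra.norm_le_norm_of_nonneg_of_le hy.1 hy.2
  have hgb : BddAbove (g '' W) := by
    refine ⟨‖g‖ * ‖(1 : A)‖, ?_⟩
    rintro _ ⟨y, hy, rfl⟩
    exact (le_abs_self _).trans ((g.le_opNorm y).trans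
      (mul_le_mul_of_nonneg_left (hnorm y hy) (norm_nonneg g)))
  set S := sSup (g '' W) with hS
  have hgS : ∀ y ∈ W, g y ≤ S := fun y hy => le_csSup hgb ⟨y, hy, rfl⟩
  let Y : ℝ → Set A := fun δ => {y | y ∈ W ∧ S - δ ≤ g y}
  have hYne : ∀ δ, 0 < δ → (F '' Y δ).Nonempty := by
    intro δ hδ
    obtain ⟨_, ⟨y, hy, rfl⟩, hlt⟩ := exists_lt_of_lt_csSup (hWne.image g)
      (show S - δ < sSup (g '' W) by rw [← hS]; linarith)
    exact ⟨F y, y, ⟨hy, hlt.le⟩, rfl⟩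
  have hYb : ∀ δ, BddAbove (F '' Y δ) := by
    intro δ
    refine ⟨F 1, ?_⟩
    rintro _ ⟨y, hy, rfl⟩
    exact hF.mono hy.1.2
  let s : ℕ → ℝ := fun n => sSup (F '' Y (ε / 2 ^ n))
  have hpow : ∀ n : ℕ, 0 < ε / 2 ^ n := fun n => by positivity
  have hs0 : ∀ n, 0 ≤ s n := by
    intro n
    obtain ⟨_, y, hy, rfl⟩ := hYne _ (hpow n)
    exact (hF _ hy.1.1).trans (le_csSup (hYb _) ⟨y, hy, rfl⟩)
  obtain ⟨n, hn⟩ : ∃ n, s n - s (n + 1) < η / 2 := by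
    by_contra hcon
    push Not at hcon
    have : ∀ n : ℕ, s n ≤ s 0 - n * (η / 2) := by
      intro n
      induction n with
      | zero => simp
      | succ n ih => have := hcon n; push_cast; linarith
    obtain ⟨n, hn⟩ := exists_nat_gt (s 0 / (η / 2))
    rw [div_lt_iff₀ (by positivity)] at hn
    linarith [this n, hs0 n]
  obtain ⟨_, ⟨a, ha, rfl⟩, hlt⟩ := exists_lt_of_lt_csSup (hYne _ (hpow (n + 1)))
    (show s (n + 1) - η / 2 < sSup (F '' Y (ε / 2 ^ (n + 1))) by
      change s (n + 1) - η / 2 < s (n + 1); linarith)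
  refine ⟨a, ha.1.1, ha.1.2, ?_, ?_⟩
  · intro y hy0 hy1
    have h1 := hgS y ⟨hy0, hy1⟩
    have h2 := ha.2
    have h3 : ε / 2 ^ (n + 1) ≤ ε := div_le_self hε.le (one_le_pow₀ (by norm_num))
    linarith
  · intro b hb0 hb1 hgab
    obtain ⟨d, hd0, hd1, hsum⟩ := exists_meet hg ha.1.1 ha.1.2 hb0 hb1
    have hc : a + (1 - a) * b * (1 - a) ∈ Y (ε / 2 ^ n) := by
      refine ⟨join_mem ha.1.1 ha.1.2 hb0 hb1, ?_⟩
      have h1 := hgS d ⟨hd0, hd1⟩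
      have h2 := ha.2
      have h3 : ε / 2 ^ n = 2 * (ε / 2 ^ (n + 1)) := by rw [pow_succ]; field_simp
      linarith
    have h4 : F (a + (1 - a) * b * (1 - a)) ≤ s n := le_csSup (hYb _) ⟨_, hc, rfl⟩
    rw [map_add] at h4
    linarith

end PositiveFunctionals

/-! ### Tracial functionals that are sums of coboundaries -/

section TracialFunctionals

variable {A : Type*} [CStarAlgebra A]

/-- Conjugation by a unitary as a real linear map. -/
def conjLinear (u : unitary A) : A →L[ℝ] A :=
  { toFun := fun x => u * x * star (u : A)
    map_add' := fun x y => by rw [mul_add, add_mul]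
    map_smul' := fun t x => by simp
    cont := by fun_prop }

theorem conjLinear_apply (u : unitary A) (x : A) : conjLinear u x = u * x * star (u : A) := rfl

variable [PartialOrder A] [StarOrderedRing A]

/-- A tracial functional `g = ∑ (φᵢ - φᵢ(uᵢ · uᵢ⋆))` is nonpositive on positive contractions. Let `F`
be the sum of the positive and negative parts of the `φᵢ` and of their conjugates, and choose `a`
as in `exists_almost_maximal`. Since `g` is invariant under conjugation, `a` and `uᵢ a uᵢ⋆` almost
dominate each other under `F`, so every `φᵢ(a - uᵢ a uᵢ⋆)` is small, and so is `g a`, which almost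
bounds `g y`. -/
theorem le_zero_of_eq_sum_sub_conj {ι : Type*} [Fintype ι] (g : A →L[ℝ] ℝ)
    (hg : ∀ y, g (star y * y) = g (y * star y)) (φ : ι → A →L[ℝ] ℝ) (u : ι → unitary A)
    (h : ∀ a, g a = ∑ i, (φ i a - φ i (conjLinear (u i) a))) {y : A} (hy0 : 0 ≤ y) (hy1 : y ≤ 1) :
    g y ≤ 0 := by
  choose p q hp hq hpq using fun i => exists_positive_sub_positive (φ i)
  have hconj : ∀ (u : unitary A) (x : A), 0 ≤ x → 0 ≤ conjLinear u x := fun u x hx =>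
    star_right_conjugate_nonneg hx _
  have hconj1 : ∀ u : unitary A, conjLinear u 1 = 1 := fun u => by
    rw [conjLinear_apply, mul_one]
    exact Unitary.coe_mul_star_self u
  set F : A →ₗ[ℝ] ℝ := ∑ i, ((p i + q i) + (p i + q i).comp (conjLinear (u i)).toLinearMap) with hF
  have hterm : ∀ i, IsPositiveFunctional
      ((p i + q i) + (p i + q i).comp (conjLinear (u i)).toLinearMap) := fun i x hx =>
    add_nonneg (add_nonneg (hp i x hx) (hq i x hx))
      (add_nonneg (hp i _ (hconj _ x hx)) (hq i _ (hconj _ x hx)))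
  have hFapply : ∀ x, F x = ∑ i, ((p i x + q i x) +
      (p i (conjLinear (u i) x) + q i (conjLinear (u i) x))) := by
    intro x
    rw [hF, LinearMap.sum_apply]
    rfl
  have hFpos : IsPositiveFunctional F := fun x hx => by
    rw [hF, LinearMap.sum_apply]
    exact Finset.sum_nonneg fun i _ => hterm i x hx
  have hle : ∀ i x, 0 ≤ x → p i x ≤ F x ∧ q i x ≤ F x ∧ p i (conjLinear (u i) x) ≤ F x ∧
      q i (conjLinear (u i) x) ≤ F x := by
    intro i x hx
    have h1 : (p i x + q i x) + (p i (conjLinear (u i) x) + q i (conjLinear (u i) x)) ≤ F x := by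
      rw [hFapply]
      exact Finset.single_le_sum (f := fun i => (p i x + q i x) +
        (p i (conjLinear (u i) x) + q i (conjLinear (u i) x)))
        (fun j _ => hterm j x hx) (Finset.mem_univ i)
    have := hp i x hx
    have := hq i x hx
    have := hp i _ (hconj (u i) x hx)
    have := hq i _ (hconj (u i) x hx)
    refine ⟨?_, ?_, ?_, ?_⟩ <;> linarith
  refine le_of_forall_pos_le_add fun ε hε => ?_
  rw [zero_add]
  set K := F 1 with hK
  have hK0 : 0 ≤ K := hFpos 1 zero_le_one
  set N : ℝ := (Fintype.card ι : ℝ) with hN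
  have hN0 : 0 ≤ N := by positivity
  -- `η` is chosen such that the error `2 N (2 K √(K η)) ^ (1 / 2)` is below `ε / 2`
  set δ := ε / (4 * (N + 1)) with hδ
  have hδ0 : 0 < δ := by positivity
  obtain ⟨η, hη, hηδ⟩ : ∃ η > 0, 2 * K * √(K * η) ≤ δ ^ 2 := by
    have hc : Filter.Tendsto (fun η : ℝ => 2 * K * √(K * η)) (nhdsWithin 0 (Set.Ioi 0)) (nhds 0) := by
      have : Continuous fun η : ℝ => 2 * K * √(K * η) := by fun_prop
      have h0 := (this.tendsto 0).mono_left (nhdsWithin_le_nhds (s := Set.Ioi 0))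
      simpa using h0
    have h1 := hc.eventually (gt_mem_nhds (show 0 < δ ^ 2 by positivity))
    obtain ⟨η, h2, h3⟩ := (h1.and self_mem_nhdsWithin).exists
    exact ⟨η, h3, h2.le⟩
  obtain ⟨a, ha0, ha1, hmax, hF'⟩ := exists_almost_maximal g hg hFpos (half_pos hε) hη
  have hterm' : ∀ i, φ i a - φ i (conjLinear (u i) a) ≤ 2 * δ := by
    intro i
    set b := conjLinear (u i) a with hb
    have hb0 : 0 ≤ b := hconj _ _ ha0
    have hb1 : b ≤ 1 := by
      have := hconj (u i) _ (sub_nonneg.2 ha1)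
      rwa [map_sub, hconj1, sub_nonneg] at this
    set v : unitary A := star (u i) with hv
    have huv : (u i : A) * (v : A) = 1 := Unitary.coe_mul_star_self (u i)
    have hvu : (v : A) * (u i : A) = 1 := Unitary.coe_star_mul_self (u i)
    have hstar : star (u i : A) = v := rfl
    have hstar' : star (v : A) = u i := by rw [hv, Unitary.coe_star, star_star]
    set b' := conjLinear v a with hb'
    have hb'0 : 0 ≤ b' := hconj _ _ ha0
    have hb'1 : b' ≤ 1 := by
      have := hconj v _ (sub_nonneg.2 ha1)
      rwa [map_sub, hconj1, sub_nonneg] at this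
    -- tracial functionals are invariant under conjugation
    have hinv : ∀ w : unitary A, g (conjLinear w a) = g a := by
      intro w
      have hsq : CFC.sqrt a * CFC.sqrt a = a := CFC.sqrt_mul_sqrt_self a ha0
      have hsa : star (CFC.sqrt a) = CFC.sqrt a :=
        (IsSelfAdjoint.of_nonneg (CFC.sqrt_nonneg a)).star_eq
      have h1 := hg (w * CFC.sqrt a)
      have e1 : star ((w : A) * CFC.sqrt a) * (w * CFC.sqrt a) = a := by
        have hw : star (w : A) * (w : A) = 1 := Unitary.coe_star_mul_self w
        rw [star_mul, hsa, mul_assoc, ← mul_assoc (star (w : A)), hw, one_mul, hsq]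
      have e2 : (w : A) * CFC.sqrt a * star ((w : A) * CFC.sqrt a) = conjLinear w a := by
        rw [star_mul, hsa, conjLinear_apply, mul_assoc, ← mul_assoc (CFC.sqrt a), hsq, mul_assoc]
      rw [e1, e2] at h1
      exact h1.symm
    have hasa : IsSelfAdjoint (1 - a) :=
      (IsSelfAdjoint.one A).sub (IsSelfAdjoint.of_nonneg ha0)
    have h1 := hF' b hb0 hb1 (hinv _)
    have h2 := hF' b' hb'0 hb'1 (hinv _)
    have hpos1 : 0 ≤ (1 - a) * b * (1 - a) := conj_nonneg_of_isSelfAdjoint hb0 hasa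
    have hpos2 : 0 ≤ (1 - a) * b' * (1 - a) := conj_nonneg_of_isSelfAdjoint hb'0 hasa
    have e : conjLinear (u i) ((1 - a) * b' * (1 - a)) = (1 - b) * a * (1 - b) := by
      have f1 : (u i : A) * (1 - a) = (1 - b) * u i := by
        rw [hb, conjLinear_apply, hstar, sub_mul, mul_assoc _ (v : A), hvu]; simp [mul_sub]
      have f2 : (1 - a) * (v : A) = v * (1 - b) := by
        rw [hb, conjLinear_apply, hstar, mul_sub, ← mul_assoc (v : A), ← mul_assoc (v : A), hvu]
        simp [sub_mul]
      rw [conjLinear_apply, hstar, hb', conjLinear_apply, hstar']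
      calc (u i : A) * ((1 - a) * (v * a * u i) * (1 - a)) * v
          = ((u i : A) * (1 - a)) * v * a * u i * ((1 - a) * v) := by simp only [mul_assoc]
        _ = (1 - b) * ((u i : A) * v) * a * ((u i : A) * v) * (1 - b) := by
            rw [f1, f2]; simp only [mul_assoc]
        _ = (1 - b) * a * (1 - b) := by rw [huv, mul_one, mul_one]
    obtain ⟨k1, k2, -, -⟩ := hle i _ hpos1
    obtain ⟨-, -, k3, k4⟩ := hle i _ hpos2
    rw [e] at k3 k4
    obtain ⟨l1, l2, -, -⟩ := hle i 1 zero_le_one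
    have m1 := (hp i).sq_sub_le l1 ha0 ha1 hb0 hb1 (k1.trans h1) (k3.trans h2)
    have m2 := (hq i).sq_sub_le l2 ha0 ha1 hb0 hb1 (k2.trans h1) (k4.trans h2)
    have n1 := abs_le_of_sq_le_sq (m1.trans hηδ) hδ0.le
    have n2 := abs_le_of_sq_le_sq (m2.trans hηδ) hδ0.le
    rw [← map_sub, hpq]
    linarith [(abs_le.1 n1).2, (abs_le.1 n2).1]
  have hga : g a ≤ N * (2 * δ) := by
    rw [h]
    refine (Finset.sum_le_card_nsmul _ _ _ fun i _ => hterm' i).trans ?_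
    rw [nsmul_eq_mul, Finset.card_univ]
  have h1 := hmax y hy0 hy1
  have h2 : N * (2 * δ) ≤ ε / 2 := by
    rw [hδ]
    have : N * (2 * (ε / (4 * (N + 1)))) = (N / (N + 1)) * (ε / 2) := by field_simp; ring
    rw [this]
    have : N / (N + 1) ≤ 1 := (div_le_one (by positivity)).2 (by linarith)
    nlinarith
  linarith

/-- A bounded tracial functional that is a sum of coboundaries `φᵢ - φᵢ(uᵢ · uᵢ⋆)` vanishes on
self-adjoint elements. -/
theorem eq_zero_of_eq_sum_sub_conj {ι : Type*} [Fintype ι] (g : A →L[ℝ] ℝ)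
    (hg : ∀ y, g (star y * y) = g (y * star y)) (φ : ι → A →L[ℝ] ℝ) (u : ι → unitary A)
    (h : ∀ a, g a = ∑ i, (φ i a - φ i (conjLinear (u i) a))) {a : A} (ha : IsSelfAdjoint a) :
    g a = 0 := by
  have h0 : ∀ y, 0 ≤ y → y ≤ 1 → g y = 0 := by
    intro y hy0 hy1
    have h1 := le_zero_of_eq_sum_sub_conj g hg φ u h hy0 hy1
    have h2 := le_zero_of_eq_sum_sub_conj (-g) (fun y => by simp [hg]) (fun i => -φ i) u
      (fun a => by
        simp only [neg_apply, h, ← Finset.sum_neg_distrib]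
        exact Finset.sum_congr rfl fun i _ => by ring) hy0 hy1
    rw [neg_apply] at h2
    linarith
  set c : ℝ := 2 * ‖a‖ + 1 with hc
  have hc0 : 0 < c := by positivity
  have h1 : a ≤ ‖a‖ • (1 : A) := by
    rw [← Algebra.algebraMap_eq_smul_one]; exact ha.le_algebraMap_norm_self
  have h2 : -(‖a‖ • (1 : A)) ≤ a := by
    rw [← Algebra.algebraMap_eq_smul_one]; exact ha.neg_algebraMap_norm_le_self
  have h3 : 0 ≤ a + ‖a‖ • (1 : A) := by
    rw [← sub_nonneg] at h2
    simpa using h2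
  have h4 : c⁻¹ • (a + ‖a‖ • (1 : A)) ≤ 1 := by
    rw [inv_smul_le_iff_of_pos hc0, hc, add_smul, two_mul, add_smul, one_smul]
    have : (0 : A) ≤ 1 := zero_le_one
    calc a + ‖a‖ • (1 : A) ≤ ‖a‖ • (1 : A) + ‖a‖ • (1 : A) := by gcongr
      _ ≤ _ := le_add_of_nonneg_right this
  have h5 := h0 _ (smul_nonneg (inv_nonneg.2 hc0.le) h3) h4
  rw [map_smul, map_add, map_smul, h0 1 zero_le_one le_rfl, smul_zero, add_zero, smul_eq_mul] at h5
  exact (mul_eq_zero.1 h5).resolve_left (inv_ne_zero hc0.ne')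

end TracialFunctionals

/-! ### Density of `Ad (CU A)` in `V A` -/

section InnerClosure

open selfAdjoint

variable {A : Type*} [CStarAlgebra A]

theorem realPart_conjLinear (u : unitary A) (x : A) :
    realPart (conjLinear u x) = conjSA u (realPart x) := by
  ext
  simp only [realPart_apply_coe, conjLinear_apply, coe_conjSA, star_mul, star_star, mul_add,
    add_mul, mul_smul_comm, smul_mul_assoc, mul_assoc]

/-- Modulo the Lie algebra of `CU A`, every self-adjoint element is equivalent to one that almost
commutes with given unitaries. By the Hahn–Banach theorem, an obstruction is a tracial functional
which is a sum of coboundaries. -/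
theorem exists_almost_commuting (a : selfAdjoint A) (s : Finset (unitary A)) {ε : ℝ}
    (hε : 0 < ε) : ∃ b : selfAdjoint A, a - b ∈ lieSet (CU A) ∧ ∀ u ∈ s, ‖b - conjSA u b‖ < ε := by
  classical
  let _ := CStarAlgebra.spectralOrder A
  have _ := CStarAlgebra.spectralOrderedRing A
  set T := complexify (lieSubspace (CU A) isClosed_CU) with hT
  let Ψ : A →L[ℝ] (s → A) := ContinuousLinearMap.pi fun u =>
    ContinuousLinearMap.id ℝ A - conjLinear (u : unitary A)
  have hΨ : ∀ x u, Ψ x u = x - conjLinear (u : unitary A) x := fun x u => rfl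
  set M : Submodule ℝ (s → A) := (T.restrictScalars ℝ).map Ψ.toLinearMap with hM
  have hmem : Ψ a ∈ closure (M : Set (s → A)) := by
    by_contra hcon
    obtain ⟨f, r, hf1, hf2⟩ := geometric_hahn_banach_closed_point
      (s := closure (M : Set (s → A))) M.convex.closure isClosed_closure hcon
    have hfM : ∀ m ∈ M, f m = 0 := by
      intro m hm
      by_contra hne
      have h1 := hf1 _ (subset_closure (M.smul_mem ((r + 1) / f m) hm))
      rw [map_smul, smul_eq_mul, div_mul_cancel₀ _ hne] at h1
      linarith
    have hr : 0 < r := by simpa using hf1 0 (subset_closure M.zero_mem)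
    have hgT : ∀ k ∈ T, f (Ψ k) = 0 := fun k hk => hfM _ ⟨k, hk, rfl⟩
    have hzero := eq_zero_of_eq_sum_sub_conj (f.comp Ψ)
      (fun y => by
        rw [← sub_eq_zero, ← map_sub]
        exact hgT _ (lie_mem_CU _ _))
      (fun u => f.comp (ContinuousLinearMap.single ℝ (fun _ : s => A) u))
      (fun u => (u : unitary A))
      (fun x => by
        rw [ContinuousLinearMap.comp_apply, ← Finset.univ_sum_single (Ψ x), map_sum]
        refine Finset.sum_congr rfl fun u _ => ?_
        rw [hΨ, Pi.single_sub, map_sub]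
        rfl)
      a.2
    rw [ContinuousLinearMap.comp_apply] at hzero
    linarith
  rw [Metric.mem_closure_iff] at hmem
  obtain ⟨_, ⟨k, hk, rfl⟩, hdist⟩ := hmem ε hε
  refine ⟨a - realPart k, ?_, fun u hu => ?_⟩
  · rw [sub_sub_cancel]
    exact hk.1
  · have h1 : ‖(a : A) - k - conjLinear u ((a : A) - k)‖ < ε := by
      have h2 : ‖Ψ ((a : A) - k) ⟨u, hu⟩‖ < ε := by
        rw [dist_eq_norm] at hdist
        rw [map_sub]
        exact (norm_le_pi_norm _ _).trans_lt hdist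
      exact h2
    refine lt_of_le_of_lt ?_ h1
    have e : a - realPart k - conjSA u (a - realPart k) =
        realPart ((a : A) - k - conjLinear u ((a : A) - k)) := by
      rw [map_sub realPart, realPart_conjLinear, map_sub realPart, selfAdjoint.realPart_coe]
    rw [e]
    exact realPart.norm_le _

/-- The exponential is `2`-Lipschitz near `0`; the global bound follows by telescoping
`exp (i b) = exp (i b / n) ^ n`. -/
theorem norm_expUnitary_sub_le (b c : selfAdjoint A) :
    ‖(expUnitary b : A) - expUnitary c‖ ≤ 2 * ‖b - c‖ := by
  have hexp : HasStrictFDerivAt (NormedSpace.exp : A → A) (1 : A →L[ℂ] A) 0 :=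
    hasStrictFDerivAt_exp_zero (𝕂 := ℂ)
  have h1 := hexp.isLittleO.def (c := 1) one_pos
  rw [Metric.eventually_nhds_iff] at h1
  obtain ⟨δ, hδ, h2⟩ := h1
  obtain ⟨n, hn⟩ := exists_nat_gt ((‖b‖ + ‖c‖) / δ)
  have hn0 : (0 : ℝ) < n := lt_of_le_of_lt (by positivity) hn
  rw [div_lt_iff₀ hδ] at hn
  have hsmall : ∀ d : selfAdjoint A, ‖d‖ ≤ ‖b‖ + ‖c‖ →
      ‖Complex.I • (((n : ℝ)⁻¹ • d : selfAdjoint A) : A)‖ < δ := by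
    intro d hd
    rw [norm_smul, Complex.norm_I, one_mul, selfAdjoint.val_smul, norm_smul, norm_inv,
      Real.norm_of_nonneg hn0.le, inv_mul_lt_iff₀ hn0]
    exact lt_of_le_of_lt hd hn
  have hstep : ‖(expUnitary ((n : ℝ)⁻¹ • b) : A) - expUnitary ((n : ℝ)⁻¹ • c)‖ ≤
      2 * ((n : ℝ)⁻¹ * ‖b - c‖) := by
    have h3 := h2 (y := (Complex.I • (((n : ℝ)⁻¹ • b : selfAdjoint A) : A),
      Complex.I • (((n : ℝ)⁻¹ • c : selfAdjoint A) : A))) (by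
        rw [dist_eq_norm, Prod.norm_def]
        refine max_lt ?_ ?_
        · simpa using! hsmall b (by linarith [norm_nonneg c])
        · simpa using! hsmall c (by linarith [norm_nonneg b]))
    simp only [one_apply_eq_self, one_mul] at h3
    have e : ‖Complex.I • (((n : ℝ)⁻¹ • b : selfAdjoint A) : A) -
        Complex.I • (((n : ℝ)⁻¹ • c : selfAdjoint A) : A)‖ = (n : ℝ)⁻¹ * ‖b - c‖ := by
      rw [← smul_sub, norm_smul, Complex.norm_I, one_mul, ← AddSubgroup.coe_sub, ← smul_sub,
        selfAdjoint.val_smul, norm_smul, norm_inv, Real.norm_of_nonneg hn0.le]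
      rfl
    rw [e] at h3
    rw [expUnitary_coe, expUnitary_coe]
    calc _ ≤ _ := norm_le_norm_add_norm_sub' _ (Complex.I • (((n : ℝ)⁻¹ • b : selfAdjoint A) : A) -
        Complex.I • (((n : ℝ)⁻¹ • c : selfAdjoint A) : A))
      _ ≤ _ := by rw [e]; linarith
  have key : ∀ k : ℕ, ‖(expUnitary ((k * (n : ℝ)⁻¹) • b) : A) -
      expUnitary ((k * (n : ℝ)⁻¹) • c)‖ ≤ k * (2 * ((n : ℝ)⁻¹ * ‖b - c‖)) := by
    intro k
    induction k with
    | zero => simp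
    | succ k ih =>
      rw [show ((k + 1 : ℕ) : ℝ) * (n : ℝ)⁻¹ = (n : ℝ)⁻¹ + k * (n : ℝ)⁻¹ by push_cast; ring,
        expUnitary_add_smul, expUnitary_add_smul, Submonoid.coe_mul, Submonoid.coe_mul]
      set x := expUnitary ((n : ℝ)⁻¹ • b)
      set y := expUnitary ((n : ℝ)⁻¹ • c)
      set v := expUnitary ((k * (n : ℝ)⁻¹) • b)
      set w := expUnitary ((k * (n : ℝ)⁻¹) • c)
      have e : (x : A) * v - y * w = (x - y) * v + y * (v - w) := by noncomm_ring
      rw [e]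
      refine (norm_add_le _ _).trans ?_
      rw [CStarRing.norm_mul_coe_unitary, CStarRing.norm_coe_unitary_mul]
      push_cast
      linarith
  have h4 := key n
  rw [mul_inv_cancel₀ hn0.ne', one_smul, one_smul] at h4
  refine h4.trans (le_of_eq ?_)
  field_simp

theorem conjStarAlgAut_mem_closureAd {H : Subgroup (unitary A)} {u : unitary A} (hu : u ∈ H) :
    Unitary.conjStarAlgAut ℂ A u ∈ closureAd H :=
  Subgroup.le_topologicalClosure _ ⟨u, hu, rfl⟩

open Filter Topology in
/-- Write `a = b + (a - b)` with `a - b` in the Lie algebra of `CU A` and `b` almost commuting with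
finitely many unitaries; then `exp (i a)` and `exp (i a) exp (-i b) ∈ CU A` induce almost the same
automorphism. -/
theorem conjStarAlgAut_expUnitary_mem (a : selfAdjoint A) :
    Unitary.conjStarAlgAut ℂ A (expUnitary a) ∈ closureAd (CU A) := by
  classical
  choose b hb hbs using fun i : Finset (unitary A) × ℕ =>
    exists_almost_commuting a i.1 (ε := 1 / ((i.2 : ℝ) + 1)) (by positivity)
  have hmem : ∀ i, expUnitary a * (expUnitary (b i))⁻¹ ∈ CU A := by
    intro i
    refine expUnitary_mul_inv_mem isClosed_CU fun t => ?_
    have e : a - conjSA (expUnitary (t • a)) (b i) =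
        (a - b i) - (conjSA (expUnitary (t • a)) (b i) - b i) := by abel
    rw [e]
    exact (lieSubspace _ isClosed_CU).sub_mem (hb i)
      (conjSA_sub_mem_lieSet_CU (expUnitary_mem_U _) _)
  have hlim : Tendsto (fun i => Unitary.conjStarAlgAut ℂ A (expUnitary a * (expUnitary (b i))⁻¹))
      atTop (𝓝 (Unitary.conjStarAlgAut ℂ A (expUnitary a))) := by
    rw [nhds_induced, tendsto_comap_iff, tendsto_pi_nhds]
    simp only [Function.comp_apply]
    -- the elements on which there is convergence form a subspace, so it suffices to treat unitaries
    let P : Submodule ℂ A :=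
      { carrier := {x | Tendsto (fun i => Unitary.conjStarAlgAut ℂ A
          (expUnitary a * (expUnitary (b i))⁻¹) x) atTop
          (𝓝 (Unitary.conjStarAlgAut ℂ A (expUnitary a) x))}
        add_mem' := fun hx hy => by
          simp only [Set.mem_ofPred_eq, map_add]
          exact Tendsto.add hx hy
        zero_mem' := by
          simp only [Set.mem_ofPred_eq, map_zero]
          exact tendsto_const_nhds
        smul_mem' := fun c x hx => by
          simp only [Set.mem_ofPred_eq, map_smul]
          exact Tendsto.const_smul hx c }
    have hP : ∀ u : unitary A, (u : A) ∈ P := by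
      intro u
      refine tendsto_iff_norm_sub_tendsto_zero.2 ?_
      have hzero : Tendsto (fun i : Finset (unitary A) × ℕ => 2 * (1 / ((i.2 : ℝ) + 1))) atTop
          (𝓝 0) := by
        have h1 : Tendsto (fun n : ℕ => 2 * (1 / ((n : ℝ) + 1))) atTop (𝓝 (2 * 0)) :=
          tendsto_one_div_add_atTop_nhds_zero_nat.const_mul 2
        rw [mul_zero] at h1
        exact h1.comp (by rw [← prod_atTop_atTop_eq]; exact tendsto_snd)
      refine squeeze_zero' (Eventually.of_forall fun _ => norm_nonneg _) ?_ hzero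
      filter_upwards [eventually_ge_atTop (({u}, 0) : Finset (unitary A) × ℕ)] with i hi
      have hu : u ∈ i.1 := hi.1 (Finset.mem_singleton_self u)
      have h1 := hbs i u hu
      set v := expUnitary a
      set w := expUnitary (b i) with hw
      have e : Unitary.conjStarAlgAut ℂ A (v * w⁻¹) (u : A) - Unitary.conjStarAlgAut ℂ A v (u : A) =
          (v : A) * (w⁻¹ : unitary A) *
            (((u * w * u⁻¹ : unitary A) : A) - w) * u * (v⁻¹ : unitary A) := by
        have e1 : Unitary.conjStarAlgAut ℂ A (v * w⁻¹) (u : A) =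
            ((v * w⁻¹ * (u * w * u⁻¹) * u * v⁻¹ : unitary A) : A) := by
          rw [show v * w⁻¹ * (u * w * u⁻¹) * u * v⁻¹ = v * w⁻¹ * u * (v * w⁻¹)⁻¹ by group]
          rfl
        have e2 : Unitary.conjStarAlgAut ℂ A v (u : A) =
            ((v * w⁻¹ * w * u * v⁻¹ : unitary A) : A) := by
          rw [show v * w⁻¹ * w * u * v⁻¹ = v * u * v⁻¹ by group]
          rfl
        rw [e1, e2]
        simp only [Submonoid.coe_mul]
        noncomm_ring
      rw [e, CStarRing.norm_mul_coe_unitary, CStarRing.norm_mul_coe_unitary, ← Submonoid.coe_mul,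
        CStarRing.norm_coe_unitary_mul, ← expUnitary_conjSA]
      refine (norm_expUnitary_sub_le _ _).trans ?_
      rw [norm_sub_rev]
      exact mul_le_mul_of_nonneg_left h1.le zero_le_two
    have htop : P = ⊤ := by
      rw [eq_top_iff, ← CStarAlgebra.span_unitary A, Submodule.span_le]
      exact fun u hu => hP ⟨u, hu⟩
    intro x
    have : x ∈ P := by rw [htop]; trivial
    exact this
  exact mem_closure_of_tendsto hlim (Eventually.of_forall fun i => ⟨_, hmem i, rfl⟩)

/-- The commutators of `U A` induce a dense subgroup of `V A`. -/
theorem V_le_closureAd_CU : V A ≤ closureAd (CU A) := by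
  refine Subgroup.topologicalClosure_minimal _ ?_ (Subgroup.isClosed_topologicalClosure _)
  rintro _ ⟨u, hu, rfl⟩
  obtain ⟨l, rfl⟩ := exists_list_prod_eq_of_mem_U hu
  rw [map_list_prod]
  refine Subgroup.list_prod_mem _ fun φ hφ => ?_
  simp only [List.map_map, List.mem_map, Function.comp_apply] at hφ
  obtain ⟨a, -, rfl⟩ := hφ
  exact conjStarAlgAut_expUnitary_mem a

end InnerClosure

/-! ### Perfect ideals -/

section PerfectIdeals

variable {A : Type*} [CStarAlgebra A]

theorem isClosed_bot_ideal : IsClosed ((⊥ : TwoSidedIdeal A) : Set A) := by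
  have e : ((⊥ : TwoSidedIdeal A) : Set A) = {0} := by
    ext x; simp
  rw [e]
  exact isClosed_singleton

theorem isClosed_closedIdealSpan (S : Set A) : IsClosed (closedIdealSpan S : Set A) := by
  have e : (closedIdealSpan S : Set A) =
      ⋂ J ∈ {J : TwoSidedIdeal A | IsClosed (J : Set A) ∧ S ⊆ J}, (J : Set A) := by
    ext x
    simp [closedIdealSpan, TwoSidedIdeal.mem_sInf]
  rw [e]
  exact isClosed_biInter fun J hJ => hJ.1

theorem closedIdealSpan_le {S : Set A} {J : TwoSidedIdeal A} (hJ : IsClosed (J : Set A))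
    (h : S ⊆ J) : closedIdealSpan S ≤ J :=
  sInf_le ⟨hJ, h⟩

theorem subset_closedIdealSpan (S : Set A) : S ⊆ closedIdealSpan S := by
  intro x hx
  rw [SetLike.mem_coe, closedIdealSpan, TwoSidedIdeal.mem_sInf]
  exact fun J hJ => hJ.2 hx

/-- A two-sided ideal as a complex subspace. -/
def idealSubmodule (J : TwoSidedIdeal A) : Submodule ℂ A where
  carrier := J
  add_mem' := J.add_mem
  zero_mem' := J.zero_mem
  smul_mem' := fun c _ hx => ideal_smul_mem J c hx

theorem closedIdealSpan_commutatorSpan_le_iff {S : Set A} {J : TwoSidedIdeal A}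
    (hJ : IsClosed (J : Set A)) :
    closedIdealSpan (commutatorSpan S S : Set A) ≤ J ↔ ∀ x ∈ S, ∀ y ∈ S, ⁅x, y⁆ ∈ J :=
  ⟨fun h _ hx _ hy => h (subset_closedIdealSpan _ (lie_mem_commutatorSpan hx hy)),
    fun h => closedIdealSpan_le hJ (commutatorSpan_le (Y := idealSubmodule J) h)⟩

/-- The ideal generated by `[I, I]` is perfect. -/
theorem isPerfectIdeal_closedIdealSpan {I : TwoSidedIdeal A} :
    IsPerfectIdeal (closedIdealSpan (commutatorSpan (I : Set A) (I : Set A) : Set A)) := by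
  set J := closedIdealSpan (commutatorSpan (I : Set A) (I : Set A) : Set A) with hJdef
  have hJ : IsClosed (J : Set A) := isClosed_closedIdealSpan _
  refine ⟨hJ, le_antisymm ?_ ?_⟩
  · set K := closedIdealSpan (commutatorSpan (J : Set A) (J : Set A) : Set A) with hK
    have hKc : IsClosed (K : Set A) := isClosed_closedIdealSpan _
    have hIJ : ∀ x ∈ I, ∀ y ∈ I, ⁅x, y⁆ ∈ J :=
      (closedIdealSpan_commutatorSpan_le_iff hJ).1 le_rfl
    have hJK : ∀ x ∈ J, ∀ y ∈ J, ⁅x, y⁆ ∈ K :=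
      (closedIdealSpan_commutatorSpan_le_iff hKc).1 le_rfl
    refine (closedIdealSpan_commutatorSpan_le_iff hKc).2 fun x hx y hy => ?_
    exact lie_mem_of_lie_central hKc (fun x _ y hy => I.mul_mem_left x y hy)
      (fun x hx y hy a => lie_mem_of_lie_mem hKc hJ hJK (hIJ x hx y hy) a) hx hy
  · refine (closedIdealSpan_commutatorSpan_le_iff hJ).2 fun x hx y hy => ?_
    exact J.sub_mem (J.mul_mem_right _ _ hx) (J.mul_mem_left _ _ hx)

theorem mem_center_iff_lie {x : A} : x ∈ Set.center A ↔ ∀ a, ⁅x, a⁆ ∈ (⊥ : TwoSidedIdeal A) := by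
  rw [Semigroup.mem_center_iff]
  simp only [TwoSidedIdeal.mem_bot, Ring.lie_def, sub_eq_zero]
  exact forall_congr' fun a => eq_comm

theorem quotient_commutative_iff {I : TwoSidedIdeal A} :
    (∀ x y : I.ringCon.Quotient, x * y = y * x) ↔ ∀ x y : A, ⁅x, y⁆ ∈ I := by
  have key : ∀ x y : A, ((x : I.ringCon.Quotient) * y = y * x) ↔ ⁅x, y⁆ ∈ I := by
    intro x y
    rw [← RingCon.coe_mul, ← RingCon.coe_mul, RingCon.eq, TwoSidedIdeal.rel_iff, Ring.lie_def]
  constructor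
  · exact fun h x y => (key x y).1 (h x y)
  · intro h x y
    induction x using Quotient.inductionOn' with | _ x
    induction y using Quotient.inductionOn' with | _ y
    exact (key x y).2 (h x y)

/-- A commutative closed ideal is central. -/
theorem subset_center_of_lie_mem_bot {I : TwoSidedIdeal A} (hI : IsClosed (I : Set A))
    (h : ∀ x ∈ I, ∀ y ∈ I, ⁅x, y⁆ ∈ (⊥ : TwoSidedIdeal A)) : (I : Set A) ⊆ Set.center A :=
  fun _ hx => mem_center_iff_lie.2 (lie_mem_of_lie_mem isClosed_bot_ideal hI h hx)

/-- Every closed ideal is central or has an abelian quotient, in terms of commutators. -/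
def IdealDichotomy (A : Type*) [CStarAlgebra A] : Prop :=
  ∀ I : TwoSidedIdeal A, IsClosed (I : Set A) →
    (I : Set A) ⊆ Set.center A ∨ ∀ x y : A, ⁅x, y⁆ ∈ I

/-- A perfect ideal that is central is zero, and one with an abelian quotient contains `[A, A]`.
Conversely, the dichotomy for `I` is read off from the perfect ideal generated by `[I, I]`: if that
is zero, then `I` is commutative and hence central. -/
theorem idealDichotomy_iff_perfect : IdealDichotomy A ↔
    ∀ I : TwoSidedIdeal A, IsPerfectIdeal I ↔ I = ⊥ ∨ I = closedIdealSpan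
      (commutatorSpan (Set.univ : Set A) (Set.univ : Set A) : Set A) := by
  have hA : IsPerfectIdeal (closedIdealSpan
      (commutatorSpan (Set.univ : Set A) (Set.univ : Set A) : Set A)) := by
    simpa using isPerfectIdeal_closedIdealSpan (A := A) (I := ⊤)
  have hclA := isClosed_closedIdealSpan
    (commutatorSpan (Set.univ : Set A) (Set.univ : Set A) : Set A)
  constructor
  · refine fun h I => ⟨fun hI => ?_, ?_⟩
    · rcases h I hI.1 with hc | hq
      · left
        rw [eq_bot_iff, hI.2]
        exact (closedIdealSpan_commutatorSpan_le_iff isClosed_bot_ideal).2 fun x hx y _ =>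
          mem_center_iff_lie.1 (hc hx) y
      · right
        refine le_antisymm ?_ ((closedIdealSpan_commutatorSpan_le_iff hI.1).2 fun x _ y _ => hq x y)
        rw [hI.2]
        refine (closedIdealSpan_commutatorSpan_le_iff hclA).2 fun x _ y _ => ?_
        exact subset_closedIdealSpan _ (lie_mem_commutatorSpan trivial trivial)
    · rintro (rfl | rfl)
      · refine ⟨isClosed_bot_ideal, le_antisymm bot_le ?_⟩
        refine (closedIdealSpan_commutatorSpan_le_iff isClosed_bot_ideal).2 fun x hx y _ => ?_
        have hx0 : x = 0 := by simpa using hx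
        simp [hx0, Ring.lie_def]
      · exact hA
  · intro h I hI
    rcases (h _).1 (isPerfectIdeal_closedIdealSpan (I := I)) with hb | ht
    · left
      refine subset_center_of_lie_mem_bot hI ?_
      exact (closedIdealSpan_commutatorSpan_le_iff isClosed_bot_ideal).1 hb.le
    · right
      intro x y
      have h1 : closedIdealSpan (commutatorSpan (I : Set A) (I : Set A) : Set A) ≤ I :=
        (closedIdealSpan_commutatorSpan_le_iff hI).2 fun x hx y _ =>
          I.sub_mem (I.mul_mem_right _ _ hx) (I.mul_mem_left _ _ hx)
      rw [ht] at h1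
      exact h1 (subset_closedIdealSpan _ (lie_mem_commutatorSpan trivial trivial))

end PerfectIdeals

/-! ### Closed groups of unitaries normalized by `CU A` -/

section NormalSubgroups

open selfAdjoint Filter Topology
open scoped commutatorElement

variable {A : Type*} [CStarAlgebra A]

/-- An automorphism `φ` with `φ a = a + z` and `φ z = z` is isometric on all `a + n z`, which
forces `z = 0`. -/
theorem eq_zero_of_aut_apply_eq_add (φ : A ≃⋆ₐ[ℂ] A) {a z : A} (ha : φ a = a + z) (hz : φ z = z) :
    z = 0 := by
  have hnorm : ∀ x, ‖φ x‖ = ‖x‖ := fun x => by simpa using dist_aut φ x 0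
  have key : ∀ n : ℕ, ‖a + n • z‖ = ‖a‖ := by
    intro n
    induction n with
    | zero => simp
    | succ n ih =>
      rw [← ih, ← hnorm (a + n • z), map_add, map_nsmul, ha, hz, succ_nsmul, add_assoc, add_comm z]
  by_contra hne
  have hpos : 0 < ‖z‖ := norm_pos_iff.2 hne
  obtain ⟨n, hn⟩ := exists_nat_gt (2 * ‖a‖ / ‖z‖)
  rw [div_lt_iff₀ hpos] at hn
  have h1 : ‖n • z‖ ≤ 2 * ‖a‖ := by
    have h2 := norm_sub_le (a + n • z) a
    rw [add_sub_cancel_left, key n] at h2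
    linarith
  rw [← Nat.cast_smul_eq_nsmul ℝ, norm_smul, Real.norm_natCast] at h1
  linarith

/-- Differentiation of the one-parameter group `exp (i t a)` at `t = 0`. -/
theorem mem_of_expUnitary_sub_one_mem {X : Submodule ℂ A} (hX : IsClosed (X : Set A))
    {a : selfAdjoint A} (h : ∀ t : ℝ, (expUnitary (t • a) : A) - 1 ∈ X) : (a : A) ∈ X := by
  have h1 := (hasDerivAt_expUnitary a).tendsto_slope_zero
  have h2 : Complex.I • (a : A) ∈ X := by
    refine hX.mem_of_tendsto h1 (Eventually.of_forall fun t => ?_)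
    rw [← Complex.coe_smul]
    simpa using! X.smul_mem _ (h t)
  have h3 := X.smul_mem (-Complex.I) h2
  rwa [smul_smul, neg_mul, Complex.I_mul_I, neg_neg, one_smul] at h3

theorem lie_mem_of_expUnitary_lie_mem {I : TwoSidedIdeal A} (hI : IsClosed (I : Set A))
    {a : selfAdjoint A} {w : A}
    (h : ∀ t : ℝ, (expUnitary (t • a) : A) * w - w * expUnitary (t • a) ∈ I) : ⁅(a : A), w⁆ ∈ I := by
  let f : A →ₗ[ℂ] A := LinearMap.mulRight ℂ w - LinearMap.mulLeft ℂ w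
  have hf : Continuous f := by
    change Continuous fun x => x * w - w * x
    fun_prop
  refine mem_of_expUnitary_sub_one_mem (X := (idealSubmodule I).comap f) (hI.preimage hf)
    fun t => ?_
  have e : f ((expUnitary (t • a) : A) - 1) =
      (expUnitary (t • a) : A) * w - w * expUnitary (t • a) := by
    change ((expUnitary (t • a) : A) - 1) * w - w * ((expUnitary (t • a) : A) - 1) = _
    noncomm_ring
  change f _ ∈ I
  rw [e]
  exact h t

theorem lie_mem_ideal_of_mem_complexify {I : TwoSidedIdeal A} {L : Submodule ℝ (selfAdjoint A)}
    {w : A} (h : ∀ x ∈ L, ⁅(x : A), w⁆ ∈ I) {z : A} (hz : z ∈ complexify L) : ⁅z, w⁆ ∈ I := by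
  have e : ⁅z, w⁆ = ⁅(realPart z : A), w⁆ + Complex.I • ⁅(imaginaryPart z : A), w⁆ := by
    conv_lhs => rw [← realPart_add_I_smul_imaginaryPart z]
    simp only [Ring.lie_def, add_mul, mul_add, smul_mul_assoc, mul_smul_comm, smul_sub]
    abel
  rw [e]
  exact I.add_mem (h _ hz.1) (ideal_smul_mem I _ (h _ hz.2))

/-- If the unitaries of two closed groups commute modulo `I`, so do their Lie algebras. -/
theorem lie_mem_of_commute_mod {I : TwoSidedIdeal A} (hI : IsClosed (I : Set A))
    {H K : Subgroup (unitary A)} {hH : IsClosed (H : Set (unitary A))}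
    {hK : IsClosed (K : Set (unitary A))}
    (h : ∀ u ∈ H, ∀ v ∈ K, (u : A) * v - v * u ∈ I) {x y : A}
    (hx : x ∈ complexify (lieSubspace H hH)) (hy : y ∈ complexify (lieSubspace K hK)) :
    ⁅x, y⁆ ∈ I := by
  have hneg : ∀ a b : A, ⁅a, b⁆ ∈ I → ⁅b, a⁆ ∈ I := fun a b hab => by
    rw [Ring.lie_def] at hab ⊢
    simpa using I.neg_mem hab
  refine lie_mem_ideal_of_mem_complexify (fun a ha => hneg _ _ ?_) hx
  refine lie_mem_ideal_of_mem_complexify (fun b hb => hneg _ _ ?_) hy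
  refine lie_mem_of_expUnitary_lie_mem hI fun t => hneg _ _ ?_
  exact lie_mem_of_expUnitary_lie_mem hI fun s => by
    have := h _ (ha t) _ (hb s)
    exact hneg _ _ this

theorem sub_one_mem_of_mem_CUIdeal {I : TwoSidedIdeal A} (hI : IsClosed (I : Set A))
    {u : unitary A} (hu : u ∈ CUIdeal I) : (u : A) - 1 ∈ I := by
  have hcl : IsClosed (unitaryOfIdeal I : Set (unitary A)) :=
    hI.preimage (f := fun u : unitary A => (u : A) - 1) (by fun_prop)
  have hle : CUIdeal I ≤ unitaryOfIdeal I := by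
    refine Subgroup.topologicalClosure_minimal _ ?_ hcl
    exact (Subgroup.commutator_le_right _ _).trans fun u hu => sub_one_mem_of_mem_UIdeal hu
  exact hle hu

theorem commutator_mem_of_sub_one_mem {I : TwoSidedIdeal A} {u : A} (hu : u - 1 ∈ I) (a : A) :
    u * a - a * u ∈ I := by
  have e : u * a - a * u = (u - 1) * a - a * (u - 1) := by noncomm_ring
  rw [e]
  exact I.sub_mem (I.mul_mem_right _ _ hu) (I.mul_mem_left _ _ hu)

/-- If `u a u⋆ - a` is central for all `a` in the Lie algebra of `CU A`, then `u` is central: it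
commutes with `[A, A]`, hence with `u c u⋆ - c = ⁅u, c⁆ u⋆` for every `c`. -/
theorem mem_center_of_conjSA_sub_mem_center {u : unitary A}
    (h : ∀ a ∈ lieSet (CU A), ((conjSA u a - a : selfAdjoint A) : A) ∈ Set.center A) :
    (u : A) ∈ Set.center A := by
  set φ := Unitary.conjStarAlgAut ℂ A u with hφ
  have hφa : ∀ x, φ x = u * x * star (u : A) := fun x => rfl
  have huu : (u : A) * star (u : A) = 1 := Unitary.coe_mul_star_self u
  have huu' : star (u : A) * (u : A) = 1 := Unitary.coe_star_mul_self u
  have hfix : ∀ x : A, (u : A) * x = x * u → φ x = x := fun x hx => by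
    rw [hφa, hx, mul_assoc, huu, mul_one]
  have hfix' : ∀ x : A, φ x = x → (u : A) * x = x * u := fun x hx => by
    conv_rhs => rw [← hx, hφa, mul_assoc, huu', mul_one]
  have h1 : ∀ a ∈ lieSet (CU A), ⁅(a : A), (u : A)⁆ ∈ (⊥ : TwoSidedIdeal A) := by
    intro a ha
    have hz := h a ha
    have h0 := eq_zero_of_aut_apply_eq_add φ (a := a) (z := (conjSA u a - a : selfAdjoint A))
      (by rw [hφa, AddSubgroup.coe_sub, coe_conjSA]; abel)
      (hfix _ (Semigroup.mem_center_iff.1 hz u))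
    rw [AddSubgroup.coe_sub, coe_conjSA, sub_eq_zero] at h0
    rw [TwoSidedIdeal.mem_bot, Ring.lie_def, hfix' _ h0, sub_self]
  have h2 : ∀ a b : A, ⁅⁅a, b⁆, (u : A)⁆ = 0 := fun a b =>
    (TwoSidedIdeal.mem_bot _).1
      (lie_mem_ideal_of_mem_complexify (L := lieSubspace _ isClosed_CU) h1 (lie_mem_CU a b))
  rw [Semigroup.mem_center_iff]
  intro c
  have hcomm : ⁅(u : A), c⁆ * u = u * ⁅(u : A), c⁆ := sub_eq_zero.1 (h2 u c)
  have h3 := eq_zero_of_aut_apply_eq_add φ (a := c) (z := ⁅(u : A), c⁆ * star (u : A))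
    (by rw [hφa, Ring.lie_def, sub_mul, mul_assoc c, huu, mul_one]; abel)
    (by
      rw [hφa, ← mul_assoc, ← hcomm, mul_assoc _ (u : A), huu, mul_one])
  have h4 : ⁅(u : A), c⁆ = 0 := by
    have := congrArg (· * (u : A)) h3
    simpa only [mul_assoc, huu', mul_one, zero_mul] using this
  exact (sub_eq_zero.1 h4).symm

/-- Under the dichotomy for ideals, a closed group of unitaries normalized by `CU A` is central or
contains `CU A`. -/
theorem subset_center_or_CU_le (hA : IdealDichotomy A) {H : Subgroup (unitary A)}
    (hH : IsClosed (H : Set (unitary A))) (hn : ∀ g ∈ CU A, ∀ h ∈ H, g * h * g⁻¹ ∈ H) :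
    (∀ h ∈ H, (h : A) ∈ Set.center A) ∨ CU A ≤ H := by
  have hT := isLieSubspace_complexify hH hn
  have hTc : IsClosed (complexify (lieSubspace H hH) : Set A) :=
    isClosed_complexify (isClosed_lieSet hH)
  rcases hA _ (isClosed_idealCore hTc) with hc | hq
  · left
    intro h hh
    refine mem_center_of_conjSA_sub_mem_center fun a ha => ?_
    have hmem : (conjSA h a - a) ∈ lieSubspace H hH := conjSA_sub_mem_of_normalizes hH hn hh ha
    set x := conjSA h a - a
    rw [mem_center_iff_lie]
    refine lie_mem_of_lie_lie_mem isClosed_bot_ideal x.2 fun b => ?_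
    have h1 := hc (hT.lie_mem_idealCore hTc _ (coe_mem_complexify.2 hmem) b)
    rw [TwoSidedIdeal.mem_bot, Ring.lie_def, Semigroup.mem_center_iff.1 h1 x, sub_self]
  · right
    refine CU_le_of_lie_mem hH fun a b => ?_
    exact lie_mem_of_lie_mem_ideal hTc (fun x hx a => lie_mem_of_mem_idealCore hx a) hq a b

/-- If `CU_I` is central in `CU_A`, then `I` is central. -/
theorem subset_center_of_CUIdeal_commute {I : TwoSidedIdeal A} (hI : IsClosed (I : Set A))
    (h : ∀ u ∈ CUIdeal I, ∀ v ∈ CU A, (u : A) * v = v * u) : (I : Set A) ⊆ Set.center A := by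
  have hcomm : ∀ x ∈ complexify (lieSubspace (CUIdeal I) (isClosed_CUIdeal I)), ∀ a b : A,
      ⁅x, ⁅a, b⁆⁆ ∈ (⊥ : TwoSidedIdeal A) := fun x hx a b =>
    lie_mem_of_commute_mod isClosed_bot_ideal
      (fun u hu v hv => by rw [h u hu v hv, sub_self]; exact TwoSidedIdeal.zero_mem _) hx
      (lie_mem_CU a b)
  have hcent : ∀ x ∈ complexify (lieSubspace (CUIdeal I) (isClosed_CUIdeal I)), ∀ a : A,
      ⁅x, a⁆ ∈ (⊥ : TwoSidedIdeal A) := fun x hx a =>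
    lie_mem_ideal_of_mem_complexify (fun y hy =>
      lie_mem_of_lie_lie_mem isClosed_bot_ideal y.2
        (fun b => hcomm _ (coe_mem_complexify.2 hy) _ _) a) hx
  refine subset_center_of_lie_mem_bot hI fun x hx y hy => ?_
  exact lie_mem_of_lie_central isClosed_bot_ideal (I := (I : Set A))
    (fun x _ y hy => I.mul_mem_left x y hy)
    (fun x hx y hy a => hcent _ (lie_mem_CUIdeal hI hx hy) a) hx hy

end NormalSubgroups

/-! ### Simplicity of `V A` and `CU A / Z(CU A)` -/

section Implications

open selfAdjoint Filter Topology
open scoped commutatorElement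

variable {A : Type*} [CStarAlgebra A]

theorem commute_of_mem_UIdeal {I : TwoSidedIdeal A} (hc : (I : Set A) ⊆ Set.center A)
    {u : unitary A} (hu : u ∈ UIdeal I) (a : A) : (u : A) * a = a * u := by
  have h := Semigroup.mem_center_iff.1 (hc (sub_one_mem_of_mem_UIdeal hu)) a
  rw [mul_sub, sub_mul, mul_one, one_mul] at h
  exact (sub_left_inj.1 h).symm

theorem CUIdeal_eq_bot {I : TwoSidedIdeal A} (hc : (I : Set A) ⊆ Set.center A) :
    CUIdeal I = ⊥ := by
  have h : ⁅UIdeal I, UIdeal I⁆ = ⊥ := by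
    rw [Subgroup.commutator_eq_bot_iff_le_centralizer]
    intro u hu
    rw [Subgroup.mem_centralizer_iff]
    intro v _
    ext
    exact (commute_of_mem_UIdeal hc hu v).symm
  rw [CUIdeal, closedCommutator, h]
  refine le_antisymm (Subgroup.topologicalClosure_minimal _ le_rfl ?_) bot_le
  simp

theorem CUIdeal_eq_bot_or_of_dichotomy (hA : IdealDichotomy A) {I : TwoSidedIdeal A}
    (hI : IsClosed (I : Set A)) : CUIdeal I = ⊥ ∨ CUIdeal I = CU A := by
  rcases subset_center_or_CU_le hA (isClosed_CUIdeal I)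
    (fun g _ h hh => (normal_CUIdeal I).conj_mem h hh g) with hc | hle
  · left
    refine CUIdeal_eq_bot (subset_center_of_CUIdeal_commute hI fun u hu v _ => ?_)
    exact (Semigroup.mem_center_iff.1 (hc u hu) v).symm
  · right
    exact le_antisymm (CUIdeal_le_CU I) hle

/-- If `CU_I = CU_A`, then `exp (i t x) - 1 ∈ I` for `x` in the Lie algebra of `CU_A`, which
contains all commutators up to complex coefficients. -/
theorem dichotomy_of_CUIdeal (h : ∀ I : TwoSidedIdeal A, IsClosed (I : Set A) →
    CUIdeal I = ⊥ ∨ CUIdeal I = CU A) : IdealDichotomy A := by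
  intro I hI
  rcases h I hI with hb | ht
  · left
    refine subset_center_of_CUIdeal_commute hI fun u hu v _ => ?_
    rw [hb, Subgroup.mem_bot] at hu
    simp [hu]
  · right
    intro a b
    have hsub : ∀ x ∈ lieSet (CU A), (x : A) ∈ I := fun x hx =>
      mem_of_expUnitary_sub_one_mem (X := idealSubmodule I) hI fun t =>
        sub_one_mem_of_mem_CUIdeal hI (by rw [ht]; exact hx t)
    have hab := lie_mem_CU a b
    rw [← realPart_add_I_smul_imaginaryPart ⁅a, b⁆]
    exact I.add_mem (hsub _ hab.1) (ideal_smul_mem I _ (hsub _ hab.2))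

theorem continuous_conjStarAlgAut :
    Continuous (Unitary.conjStarAlgAut ℂ A : unitary A → (A ≃⋆ₐ[ℂ] A)) := by
  rw [continuous_aut_iff]
  intro a
  simp only [Unitary.conjStarAlgAut_apply]
  fun_prop

theorem isClosed_closureAd (H : Subgroup (unitary A)) :
    IsClosed (closureAd H : Set (A ≃⋆ₐ[ℂ] A)) :=
  Subgroup.isClosed_topologicalClosure _

/-- A property of automorphisms that is closed and holds for `Ad u`, `u ∈ H`, holds on the closure
of these inner automorphisms. -/
theorem closureAd_induction {H : Subgroup (unitary A)} {S : Set (A ≃⋆ₐ[ℂ] A)} (hS : IsClosed S)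
    (h : ∀ u ∈ H, Unitary.conjStarAlgAut ℂ A u ∈ S) {φ : A ≃⋆ₐ[ℂ] A} (hφ : φ ∈ closureAd H) :
    φ ∈ S := by
  refine closure_minimal ?_ hS hφ
  rintro _ ⟨u, hu, rfl⟩
  exact h u hu

/-- Conjugation by `closureAd H` preserves `closureAd K` if `H` normalizes `K`. -/
theorem closureAd_conj_mem {H K : Subgroup (unitary A)} (h : ∀ u ∈ H, ∀ v ∈ K, u * v * u⁻¹ ∈ K)
    {φ ψ : A ≃⋆ₐ[ℂ] A} (hφ : φ ∈ closureAd H) (hψ : ψ ∈ closureAd K) :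
    φ * ψ * φ⁻¹ ∈ closureAd K := by
  have h1 : ∀ u ∈ H, Unitary.conjStarAlgAut ℂ A u * ψ * (Unitary.conjStarAlgAut ℂ A u)⁻¹ ∈
      closureAd K := by
    intro u hu
    refine closureAd_induction (S := (fun ψ => Unitary.conjStarAlgAut ℂ A u * ψ *
      (Unitary.conjStarAlgAut ℂ A u)⁻¹) ⁻¹' (closureAd K : Set (A ≃⋆ₐ[ℂ] A)))
      ((isClosed_closureAd K).preimage (continuous_conj _)) (fun v hv => ?_) hψ
    have := conjStarAlgAut_mem_closureAd (h u hu v hv)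
    rwa [map_mul, map_mul, map_inv] at this
  refine closureAd_induction (S := (fun φ => φ * ψ * φ⁻¹) ⁻¹' (closureAd K : Set (A ≃⋆ₐ[ℂ] A)))
    ((isClosed_closureAd K).preimage (by fun_prop)) h1 hφ

theorem VIdeal_le_V (I : TwoSidedIdeal A) : VIdeal I ≤ V A :=
  Subgroup.topologicalClosure_mono (Subgroup.map_mono (UIdeal_le_U I))

theorem VIdeal_eq_bot_or_of_simple (h : TopologicallySimple (V A)) (I : TwoSidedIdeal A) :
    VIdeal I = ⊥ ∨ VIdeal I = V A := by
  have hn : ((VIdeal I).subgroupOf (V A)).Normal := by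
    refine ⟨fun ψ hψ φ => ?_⟩
    rw [Subgroup.mem_subgroupOf] at hψ ⊢
    exact closureAd_conj_mem (fun u _ v hv => (normal_UIdeal I).conj_mem v hv u) φ.2 hψ
  have hc : IsClosed (((VIdeal I).subgroupOf (V A) : Subgroup (V A)) : Set (V A)) :=
    (isClosed_closureAd _).preimage continuous_subtype_val
  rcases h _ hn hc with hb | ht
  · left
    rw [Subgroup.subgroupOf_eq_bot, disjoint_iff, inf_eq_left.2 (VIdeal_le_V I)] at hb
    exact hb
  · right
    exact le_antisymm (VIdeal_le_V I) (Subgroup.subgroupOf_eq_top.1 ht)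

/-- If `V_I = V_A`, then `Ad u a - a ∈ I` for all `u ∈ U_A`, since this holds for `u ∈ U_I`. -/
theorem dichotomy_of_VIdeal (h : ∀ I : TwoSidedIdeal A, IsClosed (I : Set A) →
    VIdeal I = ⊥ ∨ VIdeal I = V A) : IdealDichotomy A := by
  intro I hI
  have hAd : ∀ (u : unitary A) (a : A),
      Unitary.conjStarAlgAut ℂ A u a - a = ((u : A) * a - a * u) * star (u : A) := by
    intro u a
    have huu : (u : A) * star (u : A) = 1 := Unitary.coe_mul_star_self u
    rw [sub_mul, mul_assoc a, huu, mul_one]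
    rfl
  have hAd' : ∀ (u : unitary A) (a : A),
      (u : A) * a - a * u = (Unitary.conjStarAlgAut ℂ A u a - a) * u := by
    intro u a
    have huu : star (u : A) * (u : A) = 1 := Unitary.coe_star_mul_self u
    rw [hAd, mul_assoc, huu, mul_one]
  rcases h I hI with hb | ht
  · left
    intro x hx
    refine mem_center_iff_lie.2 fun a => ?_
    refine lie_mem_ideal_of_mem_complexify (fun y hy => ?_) (mem_complexify_idealSA hI hx)
    refine lie_mem_of_expUnitary_lie_mem isClosed_bot_ideal fun t => ?_
    have h1 := conjStarAlgAut_mem_closureAd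
      (expUnitary_mem_UIdeal hI ((idealSA I).smul_mem t hy))
    change _ ∈ VIdeal I at h1
    rw [hb, Subgroup.mem_bot] at h1
    rw [hAd', h1]
    simp
  · right
    intro x a
    refine lie_mem_ideal_of_mem_complexify (L := ⊤) (fun y _ => ?_) ⟨trivial, trivial⟩
    refine lie_mem_of_expUnitary_lie_mem hI fun t => ?_
    have h1 : Unitary.conjStarAlgAut ℂ A (expUnitary (t • y)) ∈ VIdeal I := by
      rw [ht]
      exact conjStarAlgAut_mem_closureAd (expUnitary_mem_U _)
    have h2 := closureAd_induction (S := {φ : A ≃⋆ₐ[ℂ] A | φ a - a ∈ (I : Set A)})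
      (hI.preimage ((continuous_aut_eval a).sub continuous_const)) (fun u hu => ?_) h1
    · rw [hAd']
      exact I.mul_mem_right _ _ h2
    · change Unitary.conjStarAlgAut ℂ A u a - a ∈ I
      rw [hAd]
      exact I.mul_mem_right _ _ (commutator_mem_of_sub_one_mem (sub_one_mem_of_mem_UIdeal hu) a)

/-- An element of the closure of the inner automorphisms which moves every element by a central
one is trivial, since it fixes the center. -/
theorem eq_one_of_apply_sub_mem_center {φ : A ≃⋆ₐ[ℂ] A} (hφ : φ ∈ V A)
    (h : ∀ x : selfAdjoint A, φ x - x ∈ Set.center A) : φ = 1 := by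
  have hfix : ∀ z ∈ Set.center A, φ z = z := by
    intro z hz
    refine closureAd_induction (S := {φ : A ≃⋆ₐ[ℂ] A | φ z = z})
      (isClosed_eq (continuous_aut_eval z) continuous_const) (fun u _ => ?_) hφ
    change (u : A) * z * star (u : A) = z
    have huu : (u : A) * star (u : A) = 1 := Unitary.coe_mul_star_self u
    rw [Semigroup.mem_center_iff.1 hz u, mul_assoc, huu, mul_one]
  have hsa : ∀ x : selfAdjoint A, φ x = x := by
    intro x
    have := eq_zero_of_aut_apply_eq_add φ (a := x) (z := φ x - x) (by abel) (hfix _ (h x))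
    exact sub_eq_zero.1 this
  refine StarAlgEquiv.ext fun a => ?_
  conv_lhs => rw [← realPart_add_I_smul_imaginaryPart a]
  rw [map_add, map_smul, hsa, hsa, realPart_add_I_smul_imaginaryPart]
  rfl

theorem conj_mem_map_subtype {G : Type*} [Group G] {K : Subgroup G} {N : Subgroup K}
    (hN : N.Normal) {g h : G} (hg : g ∈ K) (hh : h ∈ N.map K.subtype) :
    g * h * g⁻¹ ∈ N.map K.subtype := by
  obtain ⟨h, hh, rfl⟩ := hh
  exact ⟨⟨g, hg⟩ * h * ⟨g, hg⟩⁻¹, hN.conj_mem h hh _, rfl⟩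

/-- For a closed normal subgroup `N` of `V A` let `H` be the group of unitaries `u` with `Ad u ∈ N`.
If `H` is central, then so is `φ(u) u⋆ ∈ H` for `φ ∈ N` and `u ∈ U A`, which forces `φ = 1`.
If `H` contains `CU A`, then `N` is everything because `Ad (CU A)` is dense in `V A`. -/
theorem topologicallySimple_V_of_dichotomy (hA : IdealDichotomy A) :
    TopologicallySimple (V A) := by
  intro N hN hNc
  set N' : Subgroup (A ≃⋆ₐ[ℂ] A) := N.map (V A).subtype with hN'
  have hN'c : IsClosed (N' : Set (A ≃⋆ₐ[ℂ] A)) := by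
    rw [hN', Subgroup.coe_map]
    exact (isClosed_closureAd (U A)).isClosedEmbedding_subtypeVal.isClosedMap _ hNc
  have hconj : ∀ φ ∈ V A, ∀ ψ ∈ N', φ * ψ * φ⁻¹ ∈ N' :=
    fun _ hφ _ hψ => conj_mem_map_subtype hN hφ hψ
  set H : Subgroup (unitary A) := N'.comap (Unitary.conjStarAlgAut ℂ A) with hH
  have hHc : IsClosed (H : Set (unitary A)) := hN'c.preimage continuous_conjStarAlgAut
  have hUV : ∀ u ∈ U A, Unitary.conjStarAlgAut ℂ A u ∈ V A := fun u hu =>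
    conjStarAlgAut_mem_closureAd hu
  have hHn : ∀ g ∈ CU A, ∀ h ∈ H, g * h * g⁻¹ ∈ H := by
    intro g hg h hh
    rw [hH, Subgroup.mem_comap, map_mul, map_mul, map_inv]
    exact hconj _ (hUV g (CU_le_U hg)) _ hh
  rcases subset_center_or_CU_le hA hHc hHn with hc | hle
  · left
    rw [Subgroup.eq_bot_iff_forall]
    rintro ⟨φ, hφV⟩ hφN
    have hφN' : φ ∈ N' := ⟨_, hφN, rfl⟩
    refine Subtype.ext (eq_one_of_apply_sub_mem_center hφV fun x => ?_)
    rw [mem_center_iff_lie]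
    intro a
    -- `φ(u) u⋆` is in `H`, hence central, for `u = exp (i t x)`
    set y : selfAdjoint A := ⟨φ x, (map_star φ (x : A)).symm.trans (congrArg φ x.2)⟩ with hy
    have hexp : ∀ t : ℝ, (expUnitary (t • y) : A) = φ (expUnitary (t • x)) := by
      intro t
      let +nondep : NormedAlgebra ℚ A := .restrictScalars ℚ ℂ A
      have hcont : Continuous φ := (StarAlgEquiv.isometry φ).continuous
      rw [expUnitary_coe, expUnitary_coe, NormedSpace.map_exp φ hcont, map_smul,
        selfAdjoint.val_smul, selfAdjoint.val_smul, ← Complex.coe_smul, ← Complex.coe_smul,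
        map_smul]
    have hmem : ∀ t : ℝ, expUnitary (t • y) * (expUnitary (t • x))⁻¹ ∈ H := by
      intro t
      have e : Unitary.conjStarAlgAut ℂ A (expUnitary (t • y)) =
          φ * Unitary.conjStarAlgAut ℂ A (expUnitary (t • x)) * φ⁻¹ := by
        refine StarAlgEquiv.ext fun b => ?_
        have e1 : φ (φ⁻¹ b) = b := φ.apply_symm_apply b
        change (expUnitary (t • y) : A) * b * star (expUnitary (t • y) : A) =
          φ ((expUnitary (t • x) : A) * φ⁻¹ b * star (expUnitary (t • x) : A))
        rw [map_mul, map_mul, map_star, e1, hexp]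
      rw [hH, Subgroup.mem_comap, map_mul, map_inv, e]
      have h1 := hconj _ (hUV _ (expUnitary_mem_U (t • x))) _ (N'.inv_mem hφN')
      have h2 := N'.mul_mem hφN' h1
      simpa only [mul_assoc] using h2
    have hderiv : HasDerivAt (fun t : ℝ => (expUnitary (t • y) : A) * star (expUnitary (t • x) : A))
        (Complex.I • (φ x - x)) 0 := by
      refine ((hasDerivAt_expUnitary y).fun_mul (hasDerivAt_expUnitary x).star).congr_deriv ?_
      simp [hy, sub_eq_add_neg]
    have hzero : ∀ t : ℝ, (expUnitary (t • y) : A) * star (expUnitary (t • x) : A) * a -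
        a * ((expUnitary (t • y) : A) * star (expUnitary (t • x) : A)) = 0 := by
      intro t
      rw [sub_eq_zero]
      exact (Semigroup.mem_center_iff.1 (hc _ (hmem t)) a).symm
    have hd := (hderiv.mul_const a).sub (hderiv.const_mul a)
    have hd0 : Complex.I • (φ x - x) * a - a * (Complex.I • (φ x - x)) = 0 := by
      refine hd.unique ((hasDerivAt_const (0 : ℝ) (0 : A)).congr_of_eventuallyEq ?_)
      exact Eventually.of_forall hzero
    rw [smul_mul_assoc, mul_smul_comm, ← smul_sub] at hd0
    rw [TwoSidedIdeal.mem_bot, Ring.lie_def]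
    exact (smul_eq_zero.1 hd0).resolve_left Complex.I_ne_zero
  · right
    have hV : V A ≤ N' := by
      refine V_le_closureAd_CU.trans (Subgroup.topologicalClosure_minimal _ ?_ hN'c)
      rintro _ ⟨u, hu, rfl⟩
      exact hle hu
    rw [Subgroup.eq_top_iff']
    rintro ⟨φ, hφ⟩
    obtain ⟨ψ, hψ, e⟩ := hV hφ
    have : ψ = ⟨φ, hφ⟩ := Subtype.ext e
    rwa [← this]

theorem topologicallySimple_CU_of_dichotomy (hA : IdealDichotomy A) :
    TopologicallySimple (CU A ⧸ Subgroup.center (CU A)) := by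
  intro N hN hNc
  set P : Subgroup (CU A) := N.comap (QuotientGroup.mk' _) with hP
  have hPn : P.Normal := hN.comap _
  have hPc : IsClosed (P : Set (CU A)) := hNc.preimage QuotientGroup.continuous_mk
  set H : Subgroup (unitary A) := P.map (CU A).subtype with hH
  have hHc : IsClosed (H : Set (unitary A)) := by
    rw [hH, Subgroup.coe_map]
    exact (isClosed_CU (A := A)).isClosedEmbedding_subtypeVal.isClosedMap _ hPc
  have hHn : ∀ g ∈ CU A, ∀ h ∈ H, g * h * g⁻¹ ∈ H :=
    fun _ hg _ hh => conj_mem_map_subtype hPn hg hh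
  have hmap : N = P.map (QuotientGroup.mk' _) :=
    (Subgroup.map_comap_eq_self_of_surjective (QuotientGroup.mk'_surjective _) N).symm
  rcases subset_center_or_CU_le hA hHc hHn with hc | hle
  · left
    rw [hmap, Subgroup.map_eq_bot_iff, QuotientGroup.ker_mk']
    intro u hu
    rw [Subgroup.mem_center_iff]
    intro v
    have := Semigroup.mem_center_iff.1 (hc u ⟨u, hu, rfl⟩) ((v : unitary A) : A)
    exact Subtype.ext (Subtype.ext this)
  · right
    have hPt : P = ⊤ := by
      rw [Subgroup.eq_top_iff']
      rintro u
      obtain ⟨v, hv, e⟩ := hle u.2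
      rwa [← Subtype.ext e]
    rw [hmap, hPt, Subgroup.map_top_of_surjective _ (QuotientGroup.mk'_surjective _)]

/-- The closed normal subgroup of the quotient to consider is the one induced by the closure of
`CU_I · Z(CU_A)`. If it is everything, then any two elements of `CU_A` commute modulo `I`. -/
theorem dichotomy_of_topologicallySimple_CU
    (h : TopologicallySimple (CU A ⧸ Subgroup.center (CU A))) : IdealDichotomy A := by
  intro I hI
  set C := Subgroup.center (CU A)
  set Q : Subgroup (CU A) := (CUIdeal I).subgroupOf (CU A) ⊔ C with hQ
  set M : Subgroup (CU A) := Q.topologicalClosure with hM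
  have hQn : Q.Normal := Subgroup.sup_normal _ _
  have hMn : M.Normal := Subgroup.is_normal_topologicalClosure Q
  have hCM : C ≤ M := le_sup_right.trans (Subgroup.le_topologicalClosure Q)
  have hpre : (M.map (QuotientGroup.mk' C)).comap (QuotientGroup.mk' C) = M := by
    rw [Subgroup.comap_map_eq, QuotientGroup.ker_mk', sup_eq_left.2 hCM]
  have hcl : IsClosed (M.map (QuotientGroup.mk' C) : Set (CU A ⧸ C)) := by
    rw [← (QuotientGroup.isQuotientMap_mk C).isClosed_preimage]
    have e : ((↑) : CU A → CU A ⧸ C) ⁻¹' (M.map (QuotientGroup.mk' C) : Set (CU A ⧸ C)) =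
        (M : Set (CU A)) := congrArg (fun K : Subgroup (CU A) => (K : Set (CU A))) hpre
    rw [e]
    exact Subgroup.isClosed_topologicalClosure Q
  rcases h _ (hMn.map _ (QuotientGroup.mk'_surjective C)) hcl with hb | ht
  · left
    rw [Subgroup.map_eq_bot_iff, QuotientGroup.ker_mk'] at hb
    refine subset_center_of_CUIdeal_commute hI fun u hu v hv => ?_
    have hu' : (⟨u, CUIdeal_le_CU I hu⟩ : CU A) ∈ C :=
      hb (Subgroup.le_topologicalClosure Q (le_sup_left (a := (CUIdeal I).subgroupOf (CU A)) hu))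
    have := Subgroup.mem_center_iff.1 hu' ⟨v, hv⟩
    exact (congrArg (fun w : CU A => ((w : unitary A) : A)) this).symm
  · right
    rw [ht, Subgroup.comap_top] at hpre
    -- the elements of `CU A` that are central modulo `I`
    let K : Subgroup (CU A) :=
      { carrier := {u | ∀ v : CU A, ((u : unitary A) : A) * ((v : unitary A) : A) -
          ((v : unitary A) : A) * ((u : unitary A) : A) ∈ I}
        one_mem' := fun v => by simp
        mul_mem' := by
          intro u u' hu hu' v
          have e : (((u * u' : CU A) : unitary A) : A) * ((v : unitary A) : A) -
              ((v : unitary A) : A) * (((u * u' : CU A) : unitary A) : A) =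
              ((u : unitary A) : A) * (((u' : unitary A) : A) * ((v : unitary A) : A) -
                ((v : unitary A) : A) * ((u' : unitary A) : A)) +
              (((u : unitary A) : A) * ((v : unitary A) : A) -
                ((v : unitary A) : A) * ((u : unitary A) : A)) * ((u' : unitary A) : A) := by
            simp only [Subgroup.coe_mul, Submonoid.coe_mul]
            noncomm_ring
          rw [e]
          exact I.add_mem (I.mul_mem_left _ _ (hu' v)) (I.mul_mem_right _ _ (hu v))
        inv_mem' := by
          intro u hu v
          have h1 : ((u : unitary A) : A) * (((u⁻¹ : CU A) : unitary A) : A) = 1 := by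
            rw [← Submonoid.coe_mul, ← Subgroup.coe_mul, mul_inv_cancel]; rfl
          have h2 : (((u⁻¹ : CU A) : unitary A) : A) * ((u : unitary A) : A) = 1 := by
            rw [← Submonoid.coe_mul, ← Subgroup.coe_mul, inv_mul_cancel]; rfl
          have e : (((u⁻¹ : CU A) : unitary A) : A) * ((v : unitary A) : A) -
              ((v : unitary A) : A) * (((u⁻¹ : CU A) : unitary A) : A) =
              -((((u⁻¹ : CU A) : unitary A) : A) *
                (((u : unitary A) : A) * ((v : unitary A) : A) -
                ((v : unitary A) : A) * ((u : unitary A) : A)) *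
                (((u⁻¹ : CU A) : unitary A) : A)) := by
            rw [mul_sub, sub_mul, ← mul_assoc, h2, one_mul, mul_assoc, mul_assoc, h1, mul_one]
            abel
          rw [e]
          exact I.neg_mem (I.mul_mem_right _ _ (I.mul_mem_left _ _ (hu v))) }
    have hKc : IsClosed (K : Set (CU A)) := by
      have e : (K : Set (CU A)) = ⋂ v : CU A, (fun u : CU A => ((u : unitary A) : A) *
          ((v : unitary A) : A) - ((v : unitary A) : A) * ((u : unitary A) : A)) ⁻¹'
            (I : Set A) := by
        ext u
        rw [Set.mem_iInter]
        rfl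
      rw [e]
      exact isClosed_iInter fun v => hI.preimage (by fun_prop)
    have hMK : M ≤ K := by
      refine Subgroup.topologicalClosure_minimal _ (sup_le ?_ ?_) hKc
      · intro u hu v
        exact commutator_mem_of_sub_one_mem (sub_one_mem_of_mem_CUIdeal hI hu) _
      · intro u hu v
        have := congrArg (fun w : CU A => ((w : unitary A) : A)) (Subgroup.mem_center_iff.1 hu v)
        simp only [Subgroup.coe_mul, Submonoid.coe_mul] at this
        rw [this, sub_self]
        exact I.zero_mem
    have hcomm : ∀ x ∈ complexify (lieSubspace (CU A) isClosed_CU), ∀ a b : A, ⁅x, ⁅a, b⁆⁆ ∈ I :=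
      fun x hx a b => lie_mem_of_commute_mod hI
        (fun u hu v hv => hMK (hpre ▸ Subgroup.mem_top (⟨u, hu⟩ : CU A)) ⟨v, hv⟩)
        hx (lie_mem_CU a b)
    have hcent : ∀ x ∈ complexify (lieSubspace (CU A) isClosed_CU), ∀ a : A, ⁅x, a⁆ ∈ I :=
      fun x hx a => lie_mem_ideal_of_mem_complexify (fun y hy =>
        lie_mem_of_lie_lie_mem hI y.2 (fun b => hcomm _ (coe_mem_complexify.2 hy) _ _) a) hx
    intro a b
    exact lie_mem_of_lie_central hI (I := Set.univ) (fun _ _ _ _ => trivial)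
      (fun x _ y _ c => hcent _ (lie_mem_CU x y) c) trivial trivial

end Implications
end CStarUnitary

theorem mainTheorem7 (A : Type*) [CStarAlgebra A] :
    [ -- every closed two-sided ideal is central or has abelian quotient
      ∀ I : TwoSidedIdeal A, IsClosed (I : Set A) →
        (I : Set A) ⊆ Set.center A ∨ (∀ x y : I.ringCon.Quotient, x * y = y * x),
      -- the perfect ideals are exactly `0` and the closed ideal generated by `[A, A]`
      ∀ I : TwoSidedIdeal A, CStarUnitary.IsPerfectIdeal I ↔
        I = ⊥ ∨ I = CStarUnitary.closedIdealSpan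
          (CStarUnitary.commutatorSpan (Set.univ : Set A) (Set.univ : Set A) : Set A),
      CStarUnitary.TopologicallySimple (CStarUnitary.V A),
      CStarUnitary.TopologicallySimple
        (CStarUnitary.CU A ⧸ Subgroup.center (CStarUnitary.CU A)),
      ∀ I : TwoSidedIdeal A, IsClosed (I : Set A) →
        CStarUnitary.VIdeal I = ⊥ ∨ CStarUnitary.VIdeal I = CStarUnitary.V A,
      ∀ I : TwoSidedIdeal A, IsClosed (I : Set A) →
        CStarUnitary.CUIdeal I = ⊥ ∨ CStarUnitary.CUIdeal I = CStarUnitary.CU A ].TFAE := by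
  simp only [CStarUnitary.quotient_commutative_iff]
  change [CStarUnitary.IdealDichotomy A, _, _, _, _, _].TFAE
  tfae_have 1 ↔ 2 := CStarUnitary.idealDichotomy_iff_perfect
  tfae_have 1 → 3 := CStarUnitary.topologicallySimple_V_of_dichotomy
  tfae_have 3 → 5 := fun h I _ => CStarUnitary.VIdeal_eq_bot_or_of_simple h I
  tfae_have 5 → 1 := CStarUnitary.dichotomy_of_VIdeal
  tfae_have 1 → 4 := CStarUnitary.topologicallySimple_CU_of_dichotomy
  tfae_have 4 → 1 := CStarUnitary.dichotomy_of_topologicallySimple_CU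
  tfae_have 1 → 6 := fun h _ hI => CStarUnitary.CUIdeal_eq_bot_or_of_dichotomy h hI
  tfae_have 6 → 1 := CStarUnitary.dichotomy_of_CUIdeal
  tfae_finish
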